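/- Let $\mathbb Z[i]$ be the ring of Gaussian integers and, for real $x$, let $\mathbb B_x(i)=\{\omega\in\mathbb Z[i] : |\omega|^2\le x\}$. Let $\Lambda_i:\mathbb Z[i]\to\mathbb R$ be the generalized Mangoldt function: $\Lambda_i(\omega)=\ln|\mathfrak p|$ if $\omega=\mathfrak u\,\mathfrak p^{\nu}$ for a unit $\mathfrak u$, a prime element $\mathfrak p$ of $\mathbb Z[i]$ and an integer $\nu\ge 1$, and $\Lambda_i(\omega)=0$ if $\omega$ is not of this form. Let $\arg\omega\in(-\pi,\pi]$ be the principal argument of $\omega \neq 0$ (the value of $\arg 0$ is irrelevant, as $\Lambda_i(0)=0$). Then, as $x\to\infty$ through the real numbers, $$\psi_i(x):=\sum_{\omega\in\mathbb B_x(i)}\Lambda_i(\omega)\sim 2x,$$ and, for every integer $h\neq 0$, $$\sum_{\omega\in\mathbb B_x(i)}e^{4ih\arg\omega}\,\Lambda_i(\omega)=o(x).$$ -/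

import Mathlib

open Filter Asymptotics

/-- The set `{ω ∈ ℤ[i] : |ω|² ≤ x}` is finite. -/
theorem finite_gaussianDisc (x : ℝ) : {ω : GaussianInt | ‖(ω : ℂ)‖ ^ 2 ≤ x}.Finite := by
  have hfin : ((Finset.Icc (-⌈x⌉) ⌈x⌉ ×ˢ Finset.Icc (-⌈x⌉) ⌈x⌉ : Finset (ℤ × ℤ)) :
      Set (ℤ × ℤ)).Finite := Finset.finite_toSet _
  refine (hfin.image (fun q => (⟨q.1, q.2⟩ : GaussianInt))).subset ?_
  intro ω hω
  have h1 : (ω.re : ℝ) ^ 2 + (ω.im : ℝ) ^ 2 ≤ x := by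
    have h2 : ‖(ω : ℂ)‖ ^ 2 ≤ x := hω
    rw [Complex.sq_norm, Complex.normSq_apply, ← GaussianInt.intCast_re,
      ← GaussianInt.intCast_im] at h2
    nlinarith [h2]
  have h3 : ω.re ^ 2 + ω.im ^ 2 ≤ ⌈x⌉ := by
    have h4 := h1.trans (Int.le_ceil x)
    exact_mod_cast h4
  refine ⟨(ω.re, ω.im), ?_, rfl⟩
  simp only [Finset.coe_product, Finset.coe_Icc, Set.mem_prod, Set.mem_Icc]
  have hr1 := Int.le_self_sq ω.re
  have hr2 := Int.le_self_sq (-ω.re)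
  have hi1 := Int.le_self_sq ω.im
  have hi2 := Int.le_self_sq (-ω.im)
  refine ⟨⟨?_, ?_⟩, ?_, ?_⟩ <;> nlinarith [sq_nonneg ω.re, sq_nonneg ω.im]

/-- The finite set of all Gaussian integers `ω` with `|ω|² ≤ x`. -/
noncomputable def gaussianDisc (x : ℝ) : Finset GaussianInt :=
  (finite_gaussianDisc x).toFinset

theorem mem_gaussianDisc {x : ℝ} {ω : GaussianInt} : ω ∈ gaussianDisc x ↔ ‖(ω : ℂ)‖ ^ 2 ≤ x := by
  simp [gaussianDisc]

/-- `ω = u * p ^ ν` for some unit `u` and some exponent `ν ≥ 1`, with `p` a Gaussian prime. -/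
def IsUnitMulPrimePow (p ω : GaussianInt) : Prop :=
  Prime p ∧ ∃ u : GaussianInt, IsUnit u ∧ ∃ ν : ℕ, 1 ≤ ν ∧ ω = u * p ^ ν

open Classical in
/-- The generalized Mangoldt function on `ℤ[i]`: its value at `ω` is `log |p|` if
`ω = u * p ^ ν` with a unit `u`, a prime `p` and `ν ≥ 1`, and `0` if `ω` is not of this form.
The two theorems below show that the value does not depend on the choice of `p`. -/
noncomputable def gaussianMangoldt (ω : GaussianInt) : ℝ :=
  if hω : ∃ p : GaussianInt, IsUnitMulPrimePow p ω then Real.log ‖(hω.choose : ℂ)‖ else 0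

theorem gaussianMangoldt_eq_log {p ω : GaussianInt} (hp : IsUnitMulPrimePow p ω) :
    gaussianMangoldt ω = Real.log ‖(p : ℂ)‖ := by
  have hω : ∃ p : GaussianInt, IsUnitMulPrimePow p ω := ⟨p, hp⟩
  rw [gaussianMangoldt, dif_pos hω]
  obtain ⟨hq, v, hv, m, hm, hqe⟩ := hω.choose_spec
  generalize hω.choose = q at hq hqe ⊢
  obtain ⟨hpp, u, hu, n, hn, hpe⟩ := hp
  have hdvd : p ∣ v * q ^ m := by
    rw [← hqe, hpe]
    exact (dvd_pow_self p (by omega)).mul_left u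
  have hpq : p ∣ q := by
    rcases hpp.dvd_or_dvd hdvd with h | h
    · exact absurd (isUnit_of_dvd_unit h hv) hpp.not_isUnit
    · exact hpp.dvd_of_dvd_pow h
  obtain ⟨w, hw⟩ := (hpp.dvd_prime_iff_associated hq).1 hpq
  have hwu : ‖((w : GaussianInt) : ℂ)‖ = 1 := by
    have h1 : Zsqrtd.norm (w : GaussianInt) = 1 :=
      (Zsqrtd.norm_eq_one_iff' (by norm_num) (w : GaussianInt)).2 w.isUnit
    have h2 := GaussianInt.intCast_real_norm (w : GaussianInt)
    rw [h1, Complex.normSq_eq_norm_sq] at h2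
    have h3 := norm_nonneg ((w : GaussianInt) : ℂ)
    push_cast at h2
    nlinarith
  rw [← hw, GaussianInt.toComplex_mul, norm_mul, hwu, mul_one]

theorem gaussianMangoldt_eq_zero {ω : GaussianInt} (hω : ¬ ∃ p : GaussianInt, IsUnitMulPrimePow p ω) :
    gaussianMangoldt ω = 0 := by
  rw [gaussianMangoldt, dif_neg hω]

/-- `ψ_i(x)`, the sum of the generalized Mangoldt function over `|ω|² ≤ x`. -/
noncomputable def gaussianPsi (x : ℝ) : ℝ :=
  ∑ ω ∈ gaussianDisc x, gaussianMangoldt ω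

/-! For Re s > 1 let L_k(s) be the sum of f(ω) = (ω/|ω|)^k |ω|^(-2s) over nonzero ω (`heckeL`); for
k = 4h the summand is invariant under the four units. Summing Λ over all divisors of ω, associates
included, gives 4 log|ω|. Hence the Dirichlet series of Λ twisted by (ω/|ω|)^k is -2 L_k'/L_k
(`heckeMangoldt_mul_heckeL`), and a point s₀ where L_k has order n contributes -2n/(s - s₀). By the
Wiener–Ikehara theorem (`tendsto_tsum_div_exp`) everything reduces to the line Re s = 1: there
L_{4h} must have no zero, and no singularity except a simple pole of L_0 at s = 1, which produces
the constant 2.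

The continuation to this line uses no functional equation. If αω + r, with r in a finite set R, runs
exactly once through ℤ[i], complete multiplicativity of f gives Σ_ω Σ_r (f(αω) - f(αω + r)) = (|R|
f(α) - 1) L_k(s) (`heckeDiff_eq`). This is the analogue of (1 - 2^(1-s)) ζ(s). The left side is
analytic across Re s = 1 because f varies slowly (`analyticAt_heckeDiff`). A pole at 1 + it would
force |R| f(α) = 1 for every α. The choices α = 2 and 3 exclude this for t ≠ 0, since log 2 / log 3
is irrational; α = 2 + i excludes it for t = 0, h ≠ 0, since (2 + i)/√5 is not a root of unity. For
h = t = 0 the factor with α = 2 has a simple zero and L_0 is unbounded near 1, so the pole is simple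
(`hasHeckeOrder_zero_one`).

Zeros on the line are excluded by 3 + 4 cos θ + cos 2θ ≥ 0 (`hasHeckeOrder_eq_zero`). The Tauberian
theorem needs nonnegative coefficients, so it is applied to Λ(ω)(1 + Re(c (ω/|ω|)^(4h))) with |c| ≤
1. The case c = 0 is ψ_i; subtracting it from the cases c = 1 and c = -i leaves the real and
imaginary parts of the twisted sum. -/

open Topology

/-! ### The Wiener–Ikehara theorem, by Fejér kernels -/

section Tauberian

open MeasureTheory

/-- The Fourier transform of the triangle function on `[-1, 1]`. -/
theorem integral_triangle_mul_cexp (y : ℝ) :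
    ∫ t in (-1 : ℝ)..1, ((1 - |t| : ℝ) : ℂ) * Complex.exp (Complex.I * t * y) =
      ((Real.sinc (y / 2) ^ 2 : ℝ) : ℂ) := by
  have hc : Continuous fun t : ℝ => ((1 - |t| : ℝ) : ℂ) * Complex.exp (Complex.I * t * y) := by
    fun_prop
  rw [← intervalIntegral.integral_add_adjacent_intervals (b := 0) (hc.intervalIntegrable _ _)
    (hc.intervalIntegrable _ _)]
  have e1 : ∫ t in (-1 : ℝ)..0, ((1 - |t| : ℝ) : ℂ) * Complex.exp (Complex.I * t * y) =
      ∫ t in (-1 : ℝ)..0, (1 + (t : ℂ)) * Complex.exp (Complex.I * t * y) := by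
    refine intervalIntegral.integral_congr fun t ht => ?_
    rw [Set.uIcc_of_le (by norm_num)] at ht
    simp [abs_of_nonpos ht.2]
  have e2 : ∫ t in (0 : ℝ)..1, ((1 - |t| : ℝ) : ℂ) * Complex.exp (Complex.I * t * y) =
      ∫ t in (0 : ℝ)..1, (1 - (t : ℂ)) * Complex.exp (Complex.I * t * y) := by
    refine intervalIntegral.integral_congr fun t ht => ?_
    rw [Set.uIcc_of_le (by norm_num)] at ht
    simp [abs_of_nonneg ht.1]
  rw [e1, e2]
  rcases eq_or_ne y 0 with rfl | hy
  · have h1 : ∫ t in (-1 : ℝ)..0, (1 + (t : ℂ)) = ((∫ t in (-1 : ℝ)..0, (1 + t) : ℝ) : ℂ) := by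
      rw [← intervalIntegral.integral_ofReal]; simp
    have h2 : ∫ t in (0 : ℝ)..1, (1 - (t : ℂ)) = ((∫ t in (0 : ℝ)..1, (1 - t) : ℝ) : ℂ) := by
      rw [← intervalIntegral.integral_ofReal]; simp
    simp only [Complex.ofReal_zero, mul_zero, Complex.exp_zero, mul_one, h1, h2]
    rw [intervalIntegral.integral_add (by simp) (by simp),
      intervalIntegral.integral_sub (by simp) (by simp)]
    simp
    norm_num
  have hyc : (y : ℂ) ≠ 0 := by exact_mod_cast hy
  have hexp : ∀ t : ℝ, HasDerivAt (fun t : ℝ => Complex.exp (Complex.I * t * y))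
      (Complex.exp (Complex.I * t * y) * (Complex.I * y)) t := by
    intro t
    have := (((hasDerivAt_id (t : ℂ)).const_mul Complex.I).mul_const (y : ℂ)).cexp.comp_ofReal
    simpa using this
  have hid : ∀ t : ℝ, HasDerivAt (fun t : ℝ => (t : ℂ)) 1 t := fun t =>
    (hasDerivAt_id (t : ℂ)).comp_ofReal
  have i1 : ∫ t in (-1 : ℝ)..0, (1 + (t : ℂ)) * Complex.exp (Complex.I * t * y) = _ :=
    intervalIntegral.integral_eq_sub_of_hasDerivAt
      (f := fun t : ℝ => (1 + (t : ℂ)) * Complex.exp (Complex.I * t * y) / (Complex.I * y)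
        - Complex.exp (Complex.I * t * y) / (Complex.I * y) ^ 2)
      (fun t _ => by
        have := ((((hid t).const_add 1).mul (hexp t)).div_const (Complex.I * y)).sub
          ((hexp t).div_const ((Complex.I * y) ^ 2))
        refine this.congr_deriv ?_
        field_simp
        ring)
      (Continuous.intervalIntegrable (by fun_prop) _ _)
  have i2 : ∫ t in (0 : ℝ)..1, (1 - (t : ℂ)) * Complex.exp (Complex.I * t * y) = _ :=
    intervalIntegral.integral_eq_sub_of_hasDerivAt
      (f := fun t : ℝ => (1 - (t : ℂ)) * Complex.exp (Complex.I * t * y) / (Complex.I * y)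
        + Complex.exp (Complex.I * t * y) / (Complex.I * y) ^ 2)
      (fun t _ => by
        have := ((((hid t).const_sub 1).mul (hexp t)).div_const (Complex.I * y)).add
          ((hexp t).div_const ((Complex.I * y) ^ 2))
        refine this.congr_deriv ?_
        field_simp
        ring)
      (Continuous.intervalIntegrable (by fun_prop) _ _)
  rw [i1, i2, Real.sinc_of_ne_zero (by positivity)]
  have h4 : Real.sin (y / 2) ^ 2 = (1 - Real.cos y) / 2 := by
    rw [Real.sin_sq_eq_half_sub]; ring_nf
  rw [div_pow, h4]
  push_cast
  have h5 : Complex.cos y = (Complex.exp (Complex.I * y) + Complex.exp (-(Complex.I * y))) / 2 := by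
    rw [Complex.cos]; ring_nf
  rw [h5]
  have hI : Complex.I ^ 2 = -1 := Complex.I_sq
  simp only [mul_zero, zero_mul, Complex.exp_zero, mul_one, mul_neg, neg_mul]
  have h6 : (Complex.I * (y : ℂ)) ^ 2 = -(y : ℂ) ^ 2 := by rw [mul_pow, hI]; ring
  rw [h6]
  field_simp
  ring

theorem integrable_sinc_sq : Integrable fun y : ℝ => Real.sinc y ^ 2 := by
  have hb : Integrable fun y : ℝ => 2 * (1 + y ^ 2)⁻¹ := integrable_inv_one_add_sq.const_mul 2
  refine hb.mono' (by fun_prop) (ae_of_all _ fun y => ?_)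
  rw [Real.norm_of_nonneg (sq_nonneg _), ← div_eq_mul_inv, le_div_iff₀ (by positivity)]
  have h1 : Real.sinc y ^ 2 ≤ 1 := by
    rw [sq_le_one_iff_abs_le_one]; exact abs_le.2 ⟨Real.neg_one_le_sinc y, Real.sinc_le_one y⟩
  have h2 : Real.sinc y ^ 2 * y ^ 2 ≤ 1 := by
    rcases eq_or_ne y 0 with rfl | hy
    · simp
    rw [Real.sinc_of_ne_zero hy, div_pow, div_mul_cancel₀ _ (by positivity)]
    exact Real.sin_sq_le_one y
  linarith

theorem integral_sinc_sq_pos : 0 < ∫ y : ℝ, Real.sinc y ^ 2 := by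
  refine integral_pos_of_integrable_nonneg_nonzero (x := 0) (by fun_prop) integrable_sinc_sq
    (fun y => sq_nonneg _) (by simp)

/-- Exchange of a Laplace transform along a vertical line with a Fourier transform. -/
theorem integral_mul_fourier_eq {H φ : ℝ → ℝ} {k : ℝ → ℂ} (hφ : Integrable φ)
    (hk : ∀ y : ℝ, ∫ t, (φ t : ℂ) * Complex.exp (Complex.I * t * y) = k y) {ε : ℝ}
    (hH : IntegrableOn (fun u => H u * Real.exp (-ε * u)) (Set.Ioi 0)) (v : ℝ) :
    ∫ u in Set.Ioi 0, ((H u * Real.exp (-ε * u) : ℝ) : ℂ) * k (v - u) =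
      ∫ t, ((φ t : ℂ) * Complex.exp (Complex.I * t * v)) *
        ∫ u in Set.Ioi 0, (H u : ℂ) * Complex.exp (-(ε + Complex.I * t) * u) := by
  have hprod : Integrable (Function.uncurry fun (u t : ℝ) =>
      (((H u * Real.exp (-ε * u) : ℝ) : ℂ) * (φ t : ℂ)) * Complex.exp (Complex.I * t * (v - u : ℝ)))
      ((volume.restrict (Set.Ioi 0)).prod volume) := by
    have h1 : Integrable (fun z : ℝ × ℝ => ((H z.1 * Real.exp (-ε * z.1) : ℝ) : ℂ) * (φ z.2 : ℂ))
        ((volume.restrict (Set.Ioi 0)).prod volume) := hH.ofReal.mul_prod hφ.ofReal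
    refine h1.mul_bdd (c := 1) ?_ ?_
    · exact Continuous.aestronglyMeasurable (by fun_prop)
    · refine ae_of_all _ fun z => ?_
      rw [mul_assoc, mul_comm, ← Complex.ofReal_mul, Complex.norm_exp_ofReal_mul_I]
  calc _ = ∫ u in Set.Ioi 0, ∫ t, (((H u * Real.exp (-ε * u) : ℝ) : ℂ) * (φ t : ℂ)) *
        Complex.exp (Complex.I * t * (v - u : ℝ)) := by
        refine integral_congr_ae (ae_of_all _ fun u => ?_)
        simp only
        rw [← hk, ← integral_const_mul]
        simp only [mul_assoc]
    _ = _ := by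
        rw [integral_integral_swap hprod]
        refine integral_congr_ae (ae_of_all _ fun t => ?_)
        simp only
        rw [← integral_const_mul]
        refine integral_congr_ae (ae_of_all _ fun u => ?_)
        simp only
        have : Complex.exp (Complex.I * t * (v - u : ℝ)) * Complex.exp (-ε * u) =
            Complex.exp (Complex.I * t * v) * Complex.exp (-(ε + Complex.I * t) * u) := by
          rw [← Complex.exp_add, ← Complex.exp_add]; push_cast; ring_nf
        push_cast at this ⊢
        linear_combination (H u : ℂ) * φ t * this

/-- The Riemann–Lebesgue lemma, moved to the character exp(itv) by the substitution v ↦ -v/(2π). -/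
theorem tendsto_integral_mul_cexp_atTop (f : ℝ → ℂ) :
    Tendsto (fun v : ℝ => ∫ t, f t * Complex.exp (Complex.I * t * v)) atTop (𝓝 0) := by
  have h := Real.tendsto_integral_exp_smul_cocompact f
  have h1 : Tendsto (fun v : ℝ => -(v / (2 * Real.pi))) atTop (cocompact ℝ) := by
    refine Tendsto.mono_right ?_ atBot_le_cocompact
    exact tendsto_neg_atTop_atBot.comp (tendsto_id.atTop_div_const (by positivity))
  refine (h.comp h1).congr fun v => ?_
  simp only [Function.comp]
  refine integral_congr_ae (ae_of_all _ fun t => ?_)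
  simp only [Real.fourierChar_apply, Circle.smul_def, smul_eq_mul]
  rw [mul_comm]
  congr 2
  have : (Real.pi : ℂ) ≠ 0 := by exact_mod_cast Real.pi_ne_zero
  push_cast
  field_simp

theorem tendsto_setIntegral_Ioi_comp_sub {k : ℝ → ℝ} (hk : Integrable k) :
    Tendsto (fun v => ∫ u in Set.Ioi 0, k (v - u)) atTop (𝓝 (∫ y, k y)) := by
  have h1 : ∀ v : ℝ, ∫ u in Set.Ioi 0, k (v - u) = ∫ y in Set.Iio v, k y := by
    intro v
    rw [← integral_indicator measurableSet_Ioi, ← integral_indicator measurableSet_Iio,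
      ← integral_sub_left_eq_self _ volume v]
    refine integral_congr_ae (ae_of_all _ fun u => ?_)
    simp [Set.indicator_apply]
  simp_rw [h1]
  exact (aecover_Iio tendsto_id).integral_tendsto_of_countably_generated hk

theorem setIntegral_cexp_neg_mul {z : ℂ} (hz : 0 < z.re) :
    ∫ u : ℝ in Set.Ioi 0, Complex.exp (-z * u) = 1 / z := by
  rw [integral_exp_mul_complex_Ioi (by simpa using hz)]
  simp

/-- If the Laplace transform of `S ≥ 0` differs from `A / z` by a function that is continuous up
to the imaginary axis, then `S` averaged against a kernel with compactly supported Fourier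
transform tends to `A` times the mass of the kernel. -/
theorem tendsto_setIntegral_mul_kernel {S : ℝ → ℝ} {A : ℝ} {g : ℂ → ℂ} (hS : ∀ u, 0 ≤ S u)
    (hSm : Measurable S)
    (hSint : ∀ ε > 0, IntegrableOn (fun u => S u * Real.exp (-ε * u)) (Set.Ioi 0))
    (hg : ContinuousOn g {z | 0 ≤ z.re})
    (hlap : ∀ z : ℂ, 0 < z.re →
      ∫ u in Set.Ioi 0, (S u : ℂ) * Complex.exp (-z * u) = A / z + g z)
    {φ k : ℝ → ℝ} (hφ : Continuous φ) (hφs : HasCompactSupport φ) (hkc : Continuous k)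
    (hk0 : ∀ y, 0 ≤ k y) (hki : Integrable k)
    (hk : ∀ y : ℝ, ∫ t, (φ t : ℂ) * Complex.exp (Complex.I * t * y) = k y) :
    (∀ v, IntegrableOn (fun u => S u * k (v - u)) (Set.Ioi 0)) ∧
      Tendsto (fun v => ∫ u in Set.Ioi 0, S u * k (v - u)) atTop (𝓝 (A * ∫ y, k y)) := by
  set J : ℝ → ℝ → ℂ := fun ε v => ∫ t, ((φ t : ℂ) * Complex.exp (Complex.I * t * v)) *
    g (ε + Complex.I * t) with hJ
  have hbd : ∃ M, ∀ y, ‖k y‖ ≤ M := by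
    refine ⟨∫ t, ‖φ t‖, fun y => ?_⟩
    have h1 : ‖k y‖ = ‖(k y : ℂ)‖ := by simp
    rw [h1, ← hk]
    refine (norm_integral_le_integral_norm _).trans (le_of_eq ?_)
    refine integral_congr_ae (ae_of_all _ fun t => ?_)
    have h2 : Complex.I * t * y = ((t * y : ℝ) : ℂ) * Complex.I := by push_cast; ring
    simp only [h2, norm_mul, Complex.norm_exp_ofReal_mul_I, mul_one, Complex.norm_real]
  obtain ⟨M, hM⟩ := hbd
  have hgc : ∀ ε : ℝ, 0 ≤ ε → Continuous fun t : ℝ => g (ε + Complex.I * t) := by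
    intro ε hε
    exact hg.comp_continuous (by fun_prop) (fun t => by simpa using hε)
  have hexp1 : ∀ ε > 0, IntegrableOn (fun u => A * Real.exp (-ε * u)) (Set.Ioi 0) := by
    intro ε hε
    exact (exp_neg_integrableOn_Ioi 0 hε).const_mul A
  have hbddk : ∀ v : ℝ, ∀ f : ℝ → ℝ, IntegrableOn f (Set.Ioi 0) →
      IntegrableOn (fun u => f u * k (v - u)) (Set.Ioi 0) := by
    intro v f hf
    refine Integrable.mul_bdd (c := M) hf ?_ (ae_of_all _ fun u => hM _)
    exact Continuous.aestronglyMeasurable (by fun_prop)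
  -- On the line Re z = ε the Laplace transform of S - A is exactly g, since the pole A/z is the
  -- transform of the constant A. Exchanging transforms then turns the average of S - A into `J ε
  -- v`.
  have hid : ∀ ε > 0, ∀ v, ∫ u in Set.Ioi 0, S u * Real.exp (-ε * u) * k (v - u) =
      (∫ u in Set.Ioi 0, A * Real.exp (-ε * u) * k (v - u)) + (J ε v).re := by
    intro ε hε v
    have hH : IntegrableOn (fun u => (S u - A) * Real.exp (-ε * u)) (Set.Ioi 0) := by
      simp_rw [sub_mul]
      exact (hSint ε hε).sub (hexp1 ε hε)
    have h1 := integral_mul_fourier_eq (hφ.integrable_of_hasCompactSupport hφs) hk hH v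
    have h2 : ∀ t : ℝ, ∫ u in Set.Ioi 0, ((S u - A : ℝ) : ℂ) *
        Complex.exp (-(ε + Complex.I * t) * u) = g (ε + Complex.I * t) := by
      intro t
      have hz : 0 < ((ε : ℂ) + Complex.I * t).re := by simpa using hε
      have hn : ∀ u : ℝ, ‖Complex.exp (-((ε : ℂ) + Complex.I * t) * u)‖ = Real.exp (-ε * u) := by
        intro u; rw [Complex.norm_exp]; simp
      have i1 : IntegrableOn (fun u : ℝ => (S u : ℂ) *
          Complex.exp (-((ε : ℂ) + Complex.I * t) * u)) (Set.Ioi 0) := by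
        refine (hSint ε hε).mono' ?_ (ae_of_all _ fun u => ?_)
        · exact (Complex.measurable_ofReal.comp hSm).aestronglyMeasurable.mul
            (Continuous.aestronglyMeasurable (by fun_prop))
        · rw [norm_mul, hn, Complex.norm_real, Real.norm_of_nonneg (hS u)]
      have i2 : IntegrableOn (fun u : ℝ => (A : ℂ) *
          Complex.exp (-((ε : ℂ) + Complex.I * t) * u)) (Set.Ioi 0) := by
        refine Integrable.const_mul ?_ _
        refine (exp_neg_integrableOn_Ioi 0 hε).mono'
          (Continuous.aestronglyMeasurable (by fun_prop)) (ae_of_all _ fun u => ?_)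
        rw [hn]
      simp_rw [Complex.ofReal_sub, sub_mul]
      rw [integral_sub i1 i2, hlap _ hz, integral_const_mul, setIntegral_cexp_neg_mul hz]
      ring
    simp_rw [h2] at h1
    have h3 : ∫ u in Set.Ioi 0, (((S u - A) * Real.exp (-ε * u) : ℝ) : ℂ) * (k (v - u) : ℂ) =
        ((∫ u in Set.Ioi 0, (S u - A) * Real.exp (-ε * u) * k (v - u) : ℝ) : ℂ) := by
      rw [← integral_complex_ofReal]
      simp
    rw [h3] at h1
    have h4 := congrArg Complex.re h1
    rw [Complex.ofReal_re] at h4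
    change _ = (J ε v).re at h4
    rw [← h4, ← integral_add (hbddk v _ (hexp1 ε hε)) (hbddk v _ hH)]
    refine integral_congr_ae (ae_of_all _ fun u => ?_)
    simp only
    ring
  set e : ℕ → ℝ := fun n => 1 / ((n : ℝ) + 1) with he
  have he0 : ∀ n, 0 < e n := fun n => by positivity
  have he1 : ∀ n, e n ≤ 1 := fun n => by
    rw [he]; simp only; rw [div_le_one (by positivity)]; linarith [n.cast_nonneg (α := ℝ)]
  have het : Tendsto e atTop (𝓝 0) := tendsto_one_div_add_atTop_nhds_zero_nat
  have hexpt : ∀ u, Tendsto (fun n => Real.exp (-e n * u)) atTop (𝓝 1) := by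
    intro u
    have : Tendsto (fun n => Real.exp (-e n * u)) atTop (𝓝 (Real.exp (-0 * u))) :=
      (Real.continuous_exp.tendsto _).comp ((het.neg).mul_const u)
    simpa using this
  have hJt : ∀ v, Tendsto (fun n => J (e n) v) atTop (𝓝 (J 0 v)) := by
    intro v
    -- For 0 ≤ ε ≤ 1 and t in the support of φ, the points ε + it stay in a compact subset of the
    -- closed half-plane, so g is bounded there and ε may tend to 0 under the integral.
    have hKc : IsCompact ((fun p : ℝ × ℝ => (p.1 : ℂ) + Complex.I * p.2) ''
        (Set.Icc 0 1 ×ˢ tsupport φ)) :=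
      (isCompact_Icc.prod hφs).image (by fun_prop)
    obtain ⟨C, hC⟩ := hKc.exists_bound_of_continuousOn (f := g) (hg.mono (by
      rintro _ ⟨p, hp, rfl⟩
      simpa using hp.1.1))
    refine tendsto_integral_of_dominated_convergence (fun t => ‖φ t‖ * C) ?_ ?_ ?_ ?_
    · intro n
      exact (Continuous.mul (by fun_prop) (hgc (e n) (he0 n).le)).aestronglyMeasurable
    · exact (hφ.integrable_of_hasCompactSupport hφs).norm.mul_const C
    · intro n
      refine ae_of_all _ fun t => ?_
      have h2 : Complex.I * t * v = ((t * v : ℝ) : ℂ) * Complex.I := by push_cast; ring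
      rw [h2, norm_mul, norm_mul, Complex.norm_exp_ofReal_mul_I, mul_one, Complex.norm_real]
      by_cases ht : t ∈ tsupport φ
      · exact mul_le_mul_of_nonneg_left
          (hC _ ⟨(e n, t), ⟨⟨(he0 n).le, he1 n⟩, ht⟩, rfl⟩) (norm_nonneg _)
      · simp [image_eq_zero_of_notMem_tsupport ht]
    · refine ae_of_all _ fun t => ?_
      refine Tendsto.const_mul _ ?_
      have h1 : ContinuousWithinAt g {z | 0 ≤ z.re} ((0 : ℝ) + Complex.I * t) :=
        hg _ (by simp)
      refine h1.tendsto.comp (tendsto_nhdsWithin_iff.2 ⟨?_, Eventually.of_forall fun n => ?_⟩)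
      · exact ((Complex.continuous_ofReal.tendsto 0).comp het).add_const _
      · simpa using (he0 n).le
  have hAt : ∀ v, Tendsto (fun n => ∫ u in Set.Ioi 0, A * Real.exp (-e n * u) * k (v - u)) atTop
      (𝓝 (A * ∫ u in Set.Ioi 0, k (v - u))) := by
    intro v
    have hkv : IntegrableOn (fun u => k (v - u)) (Set.Ioi 0) :=
      (hki.comp_sub_left v).integrableOn
    rw [← integral_const_mul]
    refine tendsto_integral_of_dominated_convergence (fun u => |A| * k (v - u)) ?_ ?_ ?_ ?_
    · exact fun n => Continuous.aestronglyMeasurable (by fun_prop)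
    · exact hkv.const_mul _
    · refine fun n => (ae_restrict_mem measurableSet_Ioi).mono fun u hu => ?_
      rw [norm_mul, norm_mul, Real.norm_eq_abs A, Real.norm_of_nonneg (hk0 _),
        Real.norm_of_nonneg (Real.exp_nonneg _)]
      have : Real.exp (-e n * u) ≤ 1 := Real.exp_le_one_iff.2 (by
        have := mul_pos (he0 n) hu; linarith)
      gcongr
      · exact hk0 _
      · exact mul_le_of_le_one_right (abs_nonneg _) this
    · refine ae_of_all _ fun u => ?_
      simpa using ((hexpt u).const_mul A).mul_const (k (v - u))
  have hIt : ∀ v, Tendsto (fun n => ∫ u in Set.Ioi 0, S u * Real.exp (-e n * u) * k (v - u)) atTop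
      (𝓝 (A * (∫ u in Set.Ioi 0, k (v - u)) + (J 0 v).re)) := by
    intro v
    refine ((hAt v).add ((Complex.continuous_re.tendsto _).comp (hJt v))).congr fun n => ?_
    rw [hid _ (he0 n)]
    rfl
  have hpt : ∀ v u, Tendsto (fun n => S u * Real.exp (-e n * u) * k (v - u)) atTop
      (𝓝 (S u * k (v - u))) := fun v u => by
    simpa using ((hexpt u).const_mul (S u)).mul_const (k (v - u))
  have hmeas : ∀ v n, AEStronglyMeasurable (fun u => S u * Real.exp (-e n * u) * k (v - u))
      (volume.restrict (Set.Ioi 0)) := fun v n =>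
    (hbddk v _ (hSint _ (he0 n))).aestronglyMeasurable
  -- Fatou: the integrands are nonnegative and their integrals at `e n` converge, so the limit
  -- integrand is integrable. It then serves as its own majorant in `hT`.
  have hSk : ∀ v, IntegrableOn (fun u => S u * k (v - u)) (Set.Ioi 0) := by
    intro v
    refine integrable_of_tendsto (ae_of_all _ (hpt v)) (hmeas v) ?_
    have h1 : ∀ n, ∫⁻ u in Set.Ioi 0, ‖S u * Real.exp (-e n * u) * k (v - u)‖ₑ =
        ENNReal.ofReal (∫ u in Set.Ioi 0, S u * Real.exp (-e n * u) * k (v - u)) := by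
      intro n
      rw [← ofReal_integral_norm_eq_lintegral_enorm (hbddk v _ (hSint _ (he0 n)))]
      congr 1
      refine integral_congr_ae (ae_of_all _ fun u => ?_)
      exact Real.norm_of_nonneg (mul_nonneg (mul_nonneg (hS u) (Real.exp_nonneg _)) (hk0 _))
    simp_rw [h1]
    rw [(ENNReal.tendsto_ofReal (hIt v)).liminf_eq]
    exact ENNReal.ofReal_ne_top
  refine ⟨hSk, ?_⟩
  have hT : ∀ v, ∫ u in Set.Ioi 0, S u * k (v - u) =
      A * (∫ u in Set.Ioi 0, k (v - u)) + (J 0 v).re := by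
    intro v
    refine tendsto_nhds_unique ?_ (hIt v)
    refine tendsto_integral_of_dominated_convergence _ (hmeas v) (hSk v) ?_
      (ae_of_all _ (hpt v))
    refine fun n => (ae_restrict_mem measurableSet_Ioi).mono fun u hu => ?_
    rw [norm_mul, norm_mul, Real.norm_of_nonneg (hS u), Real.norm_of_nonneg (hk0 _),
        Real.norm_of_nonneg (Real.exp_nonneg _)]
    have : Real.exp (-e n * u) ≤ 1 := Real.exp_le_one_iff.2 (by
      have := mul_pos (he0 n) hu; linarith)
    exact mul_le_mul_of_nonneg_right (mul_le_of_le_one_right (hS u) this) (hk0 _)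
  simp_rw [hT]
  -- At ε = 0 the error is the Fourier transform of t ↦ φ(t) g(it), and Riemann–Lebesgue applies.
  have hJ0 : Tendsto (fun v => (J 0 v).re) atTop (𝓝 0) := by
    have h1 := tendsto_integral_mul_cexp_atTop fun t => (φ t : ℂ) * g ((0 : ℝ) + Complex.I * t)
    have h2 := (Complex.continuous_re.tendsto _).comp h1
    rw [Complex.zero_re] at h2
    refine h2.congr fun v => ?_
    simp only [Function.comp, hJ]
    congr 2
    ext t
    ring
  simpa using ((tendsto_setIntegral_Ioi_comp_sub hki).const_mul A).add hJ0

/-- Scaled Fejér kernels: probability densities with compactly supported Fourier transform,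
concentrated near the origin. -/
theorem exists_kernel {δ η : ℝ} (hδ : 0 < δ) (hη : 0 < η) :
    ∃ φ k : ℝ → ℝ, Continuous φ ∧ HasCompactSupport φ ∧ Continuous k ∧ (∀ y, 0 ≤ k y) ∧
      Integrable k ∧ (∀ y : ℝ, ∫ t, (φ t : ℂ) * Complex.exp (Complex.I * t * y) = k y) ∧
      ∫ y, k y = 1 ∧ 1 - η ≤ ∫ y in (-δ)..δ, k y := by
  set κ : ℝ → ℝ := fun y => Real.sinc (y / 2) ^ 2 with hκ
  have hκc : Continuous κ := by fun_prop
  have hκi : Integrable κ := integrable_sinc_sq.comp_div (by norm_num)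
  have hI : 0 < ∫ y, κ y := by
    have := Measure.integral_comp_div (fun y => Real.sinc y ^ 2) (2 : ℝ)
    rw [hκ, this]
    have := integral_sinc_sq_pos
    simp only [smul_eq_mul]
    positivity
  set I := ∫ y, κ y with hIdef
  -- The interval [-lδ, lδ] exhausts the mass of κ as l grows; after dilation by l this mass sits in
  -- [-δ, δ].
  have hlim : Tendsto (fun l : ℝ => (∫ y in (-(l * δ))..(l * δ), κ y) / I) atTop (𝓝 1) := by
    have h1 : Tendsto (fun l : ℝ => l * δ) atTop atTop := tendsto_id.atTop_mul_const hδ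
    have := (intervalIntegral_tendsto_integral hκi (tendsto_neg_atTop_atBot.comp h1) h1).div_const I
    rw [← hIdef, div_self hI.ne'] at this
    exact this
  obtain ⟨l, hl1, hl0⟩ := ((hlim.eventually (eventually_ge_nhds (by linarith : 1 - η < 1))).and
    (eventually_gt_atTop 0)).exists
  -- Dilating the kernel by l stretches its triangular Fourier transform to [-l, l], so the support
  -- stays compact.
  refine ⟨fun t => max 0 (1 - |t / l|) / I, fun y => l * κ (l * y) / I, by fun_prop, ?_,
    by fun_prop, fun y => by positivity, ?_, ?_, ?_, ?_⟩
  · refine HasCompactSupport.intro (K := Set.Icc (-l) l) isCompact_Icc fun t ht => ?_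
    have h1 : l < |t| := by
      by_contra! h
      exact ht (abs_le.1 h)
    have h2 : 1 ≤ |t / l| := by
      rw [abs_div, abs_of_pos hl0, one_le_div hl0]; exact h1.le
    rw [max_eq_left (by linarith), zero_div]
  · exact ((hκi.comp_mul_left' hl0.ne').const_mul l).div_const I
  · intro y
    have h1 := Measure.integral_comp_mul_left (fun t : ℝ => ((max 0 (1 - |t / l|) / I : ℝ) : ℂ) *
      Complex.exp (Complex.I * t * y)) l
    have h2 : ∫ s : ℝ, ((max 0 (1 - |l * s / l|) / I : ℝ) : ℂ) *
        Complex.exp (Complex.I * (l * s : ℝ) * y) = (κ (l * y) / I : ℝ) := by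
      have h3 : ∀ s : ℝ, ((max 0 (1 - |l * s / l|) / I : ℝ) : ℂ) *
          Complex.exp (Complex.I * (l * s : ℝ) * y) =
          (((max 0 (1 - |s|) : ℝ) : ℂ) * Complex.exp (Complex.I * s * (l * y : ℝ))) / I := by
        intro s
        rw [mul_div_cancel_left₀ _ hl0.ne']
        push_cast
        ring_nf
      simp_rw [h3]
      rw [integral_div, ← intervalIntegral.integral_eq_integral_of_support_subset (a := -1) (b := 1)]
      · have h4 := integral_triangle_mul_cexp (l * y)
        rw [show κ (l * y) = Real.sinc (l * y / 2) ^ 2 from rfl, Complex.ofReal_div, ← h4]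
        congr 1
        refine intervalIntegral.integral_congr fun t ht => ?_
        rw [Set.uIcc_of_le (by norm_num)] at ht
        have h5 : |t| ≤ 1 := abs_le.2 ht
        rw [max_eq_right (by linarith)]
      · intro s hs
        by_contra h
        refine hs ?_
        have h5 : 1 ≤ |s| := by
          by_contra! h6
          exact h ⟨(abs_lt.1 h6).1, (abs_lt.1 h6).2.le⟩
        simp only
        rw [max_eq_left (by linarith)]
        simp
    rw [h2, abs_of_pos (inv_pos.2 hl0)] at h1
    have h6 : ∀ X : ℂ, X = l * ((l⁻¹ : ℝ) • X) := by
      intro X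
      have : (l : ℂ) ≠ 0 := by exact_mod_cast hl0.ne'
      rw [Complex.real_smul]
      push_cast
      field_simp
    rw [h6 (∫ t : ℝ, _), ← h1]
    push_cast
    ring
  · rw [integral_div, integral_const_mul, Measure.integral_comp_mul_left, abs_of_pos (inv_pos.2 hl0),
      smul_eq_mul, ← hIdef, mul_inv_cancel_left₀ hl0.ne', div_self hI.ne']
  · rw [intervalIntegral.integral_div, intervalIntegral.integral_const_mul,
      intervalIntegral.mul_integral_comp_mul_left]
    simpa using hl1

/-- If `S ≥ 0` decreases at most exponentially and its averages against kernels concentrated near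
the origin tend to `A`, then `S` itself tends to `A`. -/
theorem tendsto_of_tendsto_averages {S : ℝ → ℝ} {A : ℝ} (hS : ∀ u, 0 ≤ S u)
    (hmono : ∀ u v, u ≤ v → S u ≤ Real.exp (v - u) * S v)
    (hker : ∀ δ > 0, ∃ k : ℝ → ℝ, Continuous k ∧ (∀ y, 0 ≤ k y) ∧ Integrable k ∧
      ∫ y, k y = 1 ∧ 1 - δ ≤ ∫ y in (-δ)..δ, k y ∧
      (∀ v, IntegrableOn (fun u => S u * k (v - u)) (Set.Ioi 0)) ∧
      Tendsto (fun v => ∫ u in Set.Ioi 0, S u * k (v - u)) atTop (𝓝 A)) :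
    Tendsto S atTop (𝓝 A) := by
  have hsub : ∀ (k : ℝ → ℝ) (w δ : ℝ), 0 < δ →
      ∫ u in Set.Icc (w - δ) (w + δ), k (w - u) = ∫ y in (-δ)..δ, k y := by
    intro k w δ hδ
    rw [integral_Icc_eq_integral_Ioc, ← intervalIntegral.integral_of_le (by linarith),
      intervalIntegral.integral_comp_sub_left]
    ring_nf
  -- Centre the kernel at v + δ. On the window [v, v + 2δ] the growth condition gives S(u) ≥
  -- exp(-2δ) S(v), and the window carries kernel mass at least 1 - δ.
  have hup : ∀ δ ∈ Set.Ioo (0 : ℝ) 1, ∀ᶠ v in atTop,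
      S v ≤ Real.exp (2 * δ) * (A + δ) / (1 - δ) := by
    intro δ hδ
    obtain ⟨k, hkc, hk0, hki, -, hk2, hSk, hT⟩ := hker δ hδ.1
    have hT' : Tendsto (fun v => ∫ u in Set.Ioi 0, S u * k (v + δ - u)) atTop (𝓝 A) :=
      hT.comp (tendsto_atTop_add_const_right _ δ tendsto_id)
    filter_upwards [hT'.eventually (eventually_le_nhds (by linarith [hδ.1] : A < A + δ)),
      eventually_gt_atTop 0] with v hv hv0
    have h1 : ∫ u in Set.Icc (v + δ - δ) (v + δ + δ), Real.exp (-(2 * δ)) * S v * k (v + δ - u) ≤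
        ∫ u in Set.Ioi 0, S u * k (v + δ - u) := by
      refine le_trans (b := ∫ u in Set.Icc (v + δ - δ) (v + δ + δ), S u * k (v + δ - u)) ?_ ?_
      · refine setIntegral_mono_on ?_ ?_ measurableSet_Icc fun u hu => ?_
        · exact Continuous.integrableOn_Icc (by fun_prop)
        · refine (hSk (v + δ)).mono_set fun u hu => ?_
          have := hu.1
          simp only [Set.mem_Ioi]
          linarith
        · refine mul_le_mul_of_nonneg_right ?_ (hk0 _)
          have h2 := hmono v u (by linarith [hu.1])
          have h3 : Real.exp (u - v) ≤ Real.exp (2 * δ) := Real.exp_le_exp.2 (by linarith [hu.2])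
          calc Real.exp (-(2 * δ)) * S v ≤ Real.exp (-(2 * δ)) * (Real.exp (2 * δ) * S u) := by
                have := mul_le_mul_of_nonneg_right h3 (hS u)
                gcongr
                linarith
            _ = S u := by rw [← mul_assoc, ← Real.exp_add]; simp
      · refine setIntegral_mono_set (hSk _)
          (ae_of_all _ fun u => mul_nonneg (hS u) (hk0 _)) ?_
        refine LE.le.eventuallyLE fun u hu => ?_
        have := hu.1
        simp only [Set.mem_Ioi]
        linarith
    rw [integral_const_mul, hsub _ _ _ hδ.1] at h1
    rw [le_div_iff₀ (by linarith [hδ.2])]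
    have h4 : Real.exp (-(2 * δ)) * S v * (1 - δ) ≤ A + δ :=
      (mul_le_mul_of_nonneg_left hk2 (mul_nonneg (Real.exp_nonneg _) (hS v))).trans (h1.trans hv)
    calc S v * (1 - δ) = Real.exp (2 * δ) * (Real.exp (-(2 * δ)) * S v * (1 - δ)) := by
          rw [mul_assoc, ← mul_assoc, ← Real.exp_add]; simp
      _ ≤ _ := by gcongr
  -- The lower bound needs S bounded to control the kernel tails: far out the upper bound suffices,
  -- and below v₀ the growth condition transports the value at v₀.
  obtain ⟨M, hM⟩ : ∃ M, ∀ u, 0 < u → S u ≤ M := by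
    obtain ⟨v₀, hv₀⟩ := eventually_atTop.1 (hup (1 / 2) ⟨by norm_num, by norm_num⟩)
    set C := Real.exp (2 * (1 / 2)) * (A + 1 / 2) / (1 - 1 / 2) with hC
    refine ⟨Real.exp |v₀| * C, fun u hu => ?_⟩
    have hC0 : 0 ≤ C := (hS _).trans (hv₀ v₀ le_rfl)
    have he : 1 ≤ Real.exp |v₀| := Real.one_le_exp (abs_nonneg _)
    rcases le_total v₀ u with h | h
    · exact (hv₀ u h).trans (le_mul_of_one_le_left hC0 he)
    · refine (hmono u v₀ h).trans ?_
      have : Real.exp (v₀ - u) ≤ Real.exp |v₀| :=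
        Real.exp_le_exp.2 (by linarith [le_abs_self v₀])
      exact mul_le_mul this (hv₀ _ le_rfl) (hS _) (Real.exp_nonneg _)
  have hM0 : 0 ≤ M := (hS 1).trans (hM 1 one_pos)
  -- Centre the kernel at v - δ. On [v - 2δ, v] one has S(u) ≤ exp(2δ) S(v); outside, S ≤ M meets
  -- kernel mass at most δ. The function `B` below is the sum of these two majorants.
  have hlo : ∀ δ ∈ Set.Ioo (0 : ℝ) 1, ∀ᶠ v in atTop,
      Real.exp (-(2 * δ)) * (A - δ - M * δ) ≤ S v := by
    intro δ hδ
    obtain ⟨k, hkc, hk0, hki, hk1, hk2, hSk, hT⟩ := hker δ hδ.1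
    have hT' : Tendsto (fun v => ∫ u in Set.Ioi 0, S u * k (v - δ - u)) atTop (𝓝 A) :=
      hT.comp (tendsto_atTop_add_const_right _ (-δ) tendsto_id)
    filter_upwards [hT'.eventually (eventually_ge_nhds (by linarith [hδ.1] : A - δ < A)),
      eventually_gt_atTop (2 * δ)] with v hv hv0
    set w := v - δ with hw
    set B : ℝ → ℝ := fun u => Real.exp (2 * δ) * S v * k (w - u) +
      M * (k (w - u) - (Set.Icc (w - δ) (w + δ)).indicator (fun u => k (w - u)) u) with hB
    have hkw : Integrable fun u => k (w - u) := hki.comp_sub_left w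
    have hki' : Integrable fun u => k (w - u) -
        (Set.Icc (w - δ) (w + δ)).indicator (fun u => k (w - u)) u :=
      hkw.sub (hkw.indicator measurableSet_Icc)
    have hBi : Integrable B := (hkw.const_mul _).add (hki'.const_mul M)
    have hind : ∀ u, 0 ≤ k (w - u) -
        (Set.Icc (w - δ) (w + δ)).indicator (fun u => k (w - u)) u := by
      intro u
      rw [sub_nonneg]
      exact Set.indicator_le_self' (fun _ _ => hk0 _) u
    have hfirst : ∀ u, 0 ≤ Real.exp (2 * δ) * S v * k (w - u) := fun u =>
      mul_nonneg (mul_nonneg (Real.exp_nonneg _) (hS v)) (hk0 _)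
    have h1 : ∫ u in Set.Ioi 0, S u * k (w - u) ≤ ∫ u, B u := by
      refine (setIntegral_mono_on (hSk w) hBi.integrableOn measurableSet_Ioi fun u hu => ?_).trans
        (setIntegral_le_integral hBi (ae_of_all _ fun u =>
          add_nonneg (hfirst u) (mul_nonneg hM0 (hind u))))
      by_cases hmem : u ∈ Set.Icc (w - δ) (w + δ)
      · refine le_trans ?_ (le_add_of_nonneg_right (mul_nonneg hM0 (hind u)))
        refine mul_le_mul_of_nonneg_right ?_ (hk0 _)
        refine (hmono u v (by linarith [hmem.2])).trans ?_
        refine mul_le_mul_of_nonneg_right (Real.exp_le_exp.2 (by linarith [hmem.1])) (hS v)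
      · refine le_trans ?_ (le_add_of_nonneg_left (hfirst u))
        rw [Set.indicator_of_notMem hmem, sub_zero]
        exact mul_le_mul_of_nonneg_right (hM u hu) (hk0 _)
    have h2 : ∫ u, B u = Real.exp (2 * δ) * S v + M * (1 - ∫ y in (-δ)..δ, k y) := by
      rw [show ∫ u, B u = _ from integral_add (hkw.const_mul _) (hki'.const_mul M),
        integral_const_mul, integral_const_mul, integral_sub hkw (hkw.indicator measurableSet_Icc),
        integral_sub_left_eq_self (fun u => k u) volume w, hk1,
        integral_indicator measurableSet_Icc, hsub _ _ _ hδ.1, mul_one]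
    have h3 : A - δ - M * δ ≤ Real.exp (2 * δ) * S v := by
      have : M * (1 - ∫ y in (-δ)..δ, k y) ≤ M * δ := by gcongr; linarith
      linarith
    calc _ ≤ Real.exp (-(2 * δ)) * (Real.exp (2 * δ) * S v) := by gcongr
      _ = S v := by rw [← mul_assoc, ← Real.exp_add]; simp
  have hsmall : ∀ᶠ δ : ℝ in 𝓝[>] 0, δ ∈ Set.Ioo (0 : ℝ) 1 := Ioo_mem_nhdsGT one_pos
  refine tendsto_order.2 ⟨fun a ha => ?_, fun a ha => ?_⟩
  · have hc : Tendsto (fun δ : ℝ => Real.exp (-(2 * δ)) * (A - δ - M * δ)) (𝓝[>] 0) (𝓝 A) := by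
      have : ContinuousAt (fun δ : ℝ => Real.exp (-(2 * δ)) * (A - δ - M * δ)) 0 := by fun_prop
      have h := this.tendsto.mono_left (nhdsWithin_le_nhds (s := Set.Ioi 0))
      simpa using h
    obtain ⟨δ, h1, h2⟩ := ((hc.eventually (eventually_gt_nhds ha)).and hsmall).exists
    filter_upwards [hlo δ h2] with v hv
    exact h1.trans_le hv
  · have hc : Tendsto (fun δ : ℝ => Real.exp (2 * δ) * (A + δ) / (1 - δ)) (𝓝[>] 0) (𝓝 A) := by
      have : ContinuousAt (fun δ : ℝ => Real.exp (2 * δ) * (A + δ) / (1 - δ)) 0 :=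
        ContinuousAt.div (by fun_prop) (by fun_prop) (by norm_num)
      have h := this.tendsto.mono_left (nhdsWithin_le_nhds (s := Set.Ioi 0))
      simpa using h
    obtain ⟨δ, h1, h2⟩ := ((hc.eventually (eventually_lt_nhds ha)).and hsmall).exists
    filter_upwards [hup δ h2] with v hv
    exact hv.trans_lt h1

/-- The Wiener–Ikehara theorem for Laplace transforms. -/
theorem tendsto_of_laplace {S : ℝ → ℝ} {A : ℝ} {g : ℂ → ℂ} (hS : ∀ u, 0 ≤ S u)
    (hSm : Measurable S) (hmono : ∀ u v, u ≤ v → S u ≤ Real.exp (v - u) * S v)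
    (hSint : ∀ ε > 0, IntegrableOn (fun u => S u * Real.exp (-ε * u)) (Set.Ioi 0))
    (hg : ContinuousOn g {z | 0 ≤ z.re})
    (hlap : ∀ z : ℂ, 0 < z.re →
      ∫ u in Set.Ioi 0, (S u : ℂ) * Complex.exp (-z * u) = A / z + g z) :
    Tendsto S atTop (𝓝 A) := by
  refine tendsto_of_tendsto_averages hS hmono fun δ hδ => ?_
  obtain ⟨φ, k, hφ, hφs, hkc, hk0, hki, hk, hk1, hkδ⟩ := exists_kernel hδ hδ
  have h := tendsto_setIntegral_mul_kernel hS hSm hSint hg hlap hφ hφs hkc hk0 hki hk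
  rw [hk1, mul_one] at h
  exact ⟨k, hkc, hk0, hki, hk1, hkδ, h⟩

/-- Partial fractions: A/(z(1 + z)) = A/z - A/(1 + z). Dividing by 1 + z, which the Laplace
transform of a step function introduces, therefore leaves the polar part at z = 0 unchanged. -/
theorem exists_tendsto_sub_div_of_shift {G : ℂ → ℂ} {A : ℝ} {z₀ : ℂ} (hz₀ : 0 ≤ z₀.re)
    (h : ∃ c, Tendsto (fun s => G s - A / (s - 1)) (𝓝[{s | 1 < s.re}] (1 + z₀)) (𝓝 c)) :
    ∃ c, Tendsto (fun z => G (1 + z) / (1 + z) - A / z) (𝓝[{z | 0 < z.re}] z₀) (𝓝 c) := by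
  obtain ⟨c, hc⟩ := h
  have hne : (1 + z₀) ≠ 0 := by
    intro h0
    have := congrArg Complex.re h0
    simp at this
    linarith
  have h1 : Tendsto (fun z : ℂ => 1 + z) (𝓝[{z | 0 < z.re}] z₀) (𝓝[{s | 1 < s.re}] (1 + z₀)) := by
    refine tendsto_nhdsWithin_iff.2 ⟨?_, eventually_mem_nhdsWithin.mono fun z hz => ?_⟩
    · exact (Continuous.tendsto (by fun_prop) _).mono_left nhdsWithin_le_nhds
    · simpa using hz
  have h2 := h1.mono_right nhdsWithin_le_nhds
  refine ⟨c / (1 + z₀) - A / (1 + z₀), (((hc.comp h1).div h2 hne).sub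
    (tendsto_const_nhds.div h2 hne)).congr' ?_⟩
  filter_upwards [eventually_mem_nhdsWithin] with z hz
  have hz0 : z ≠ 0 := by rintro rfl; simp at hz
  have hz1 : 1 + z ≠ 0 := by
    intro h0
    have := congrArg Complex.re h0
    have hz' : 0 < z.re := hz
    simp at this
    linarith
  change (G (1 + z) - A / (1 + z - 1)) / (1 + z) - A / (1 + z) = _
  rw [add_sub_cancel_left]
  field_simp
  ring

theorem integrableOn_indicator_cexp (b u : ℝ) {w : ℂ} (hw : 0 < w.re) :
    IntegrableOn (fun t : ℝ => (if u ≤ t then (b : ℂ) else 0) * Complex.exp (-w * t))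
      (Set.Ioi 0) := by
  refine Integrable.bdd_mul (c := |b|) (g := fun t : ℝ => Complex.exp (-w * t)) ?_ ?_ ?_
  · exact integrableOn_exp_mul_complex_Ioi (by simpa using hw) 0
  · exact (Measurable.ite measurableSet_Ici measurable_const measurable_const).aestronglyMeasurable
  · refine ae_of_all _ fun t => ?_
    split_ifs <;> simp

/-- Partial summation in integral form: summed over all steps, this identifies the Laplace transform
of the summatory function with the Dirichlet series divided by w. -/
theorem setIntegral_indicator_cexp (b : ℝ) {u : ℝ} (hu : 0 ≤ u) {w : ℂ} (hw : 0 < w.re) :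
    ∫ t : ℝ in Set.Ioi 0, (if u ≤ t then (b : ℂ) else 0) * Complex.exp (-w * t) =
      b * Complex.exp (-w * u) / w := by
  have h1 : ∀ t : ℝ, (if u ≤ t then (b : ℂ) else 0) * Complex.exp (-w * t) =
      (Set.Ici u).indicator (fun t : ℝ => (b : ℂ) * Complex.exp (-w * t)) t := by
    intro t
    simp [Set.indicator_apply]
  simp_rw [h1]
  rw [← integral_Ici_eq_integral_Ioi, setIntegral_indicator measurableSet_Ici,
    Set.Ici_inter_Ici, sup_eq_right.2 hu, integral_Ici_eq_integral_Ioi, integral_const_mul,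
    integral_exp_mul_complex_Ioi (by simpa using hw)]
  field_simp

/-- The Wiener–Ikehara theorem for generalized Dirichlet series `∑ aᵢ exp (-s uᵢ)`. -/
theorem tendsto_tsum_div_exp {ι : Type*} [Countable ι] {a u : ι → ℝ} (ha : ∀ i, 0 ≤ a i)
    (hu : ∀ i, 0 ≤ u i) (hsum : ∀ σ : ℝ, 1 < σ → Summable fun i => a i * Real.exp (-σ * u i))
    {A : ℝ} {G : ℂ → ℂ} (hG : ∀ s : ℂ, 1 < s.re → ∑' i, (a i : ℂ) * Complex.exp (-s * u i) = G s)
    (hlim : ∀ s₀ : ℂ, 1 ≤ s₀.re →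
      ∃ c, Tendsto (fun s => G s - A / (s - 1)) (𝓝[{s | 1 < s.re}] s₀) (𝓝 c)) :
    Tendsto (fun v : ℝ => Real.exp (-v) * ∑' i, if u i ≤ v then a i else 0) atTop (𝓝 A) := by
  have hs : ∀ v : ℝ, Summable fun i => if u i ≤ v then a i else 0 := by
    intro v
    refine Summable.of_nonneg_of_le (fun i => ?_) (fun i => ?_)
      ((hsum 2 one_lt_two).mul_right (Real.exp (2 * |v|)))
    · split_ifs
      exacts [ha i, le_rfl]
    · have h1 : 0 ≤ a i * Real.exp (-2 * u i) * Real.exp (2 * |v|) := by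
        have := ha i
        positivity
      split_ifs with h
      · rw [mul_assoc, ← Real.exp_add]
        refine le_mul_of_one_le_right (ha i) (Real.one_le_exp ?_)
        linarith [le_abs_self v]
      · exact h1
  set ψ : ℝ → ℝ := fun v => ∑' i, if u i ≤ v then a i else 0 with hψ
  have hψmono : Monotone ψ := by
    intro v w hvw
    refine (hs v).tsum_le_tsum (fun i => ?_) (hs w)
    by_cases h : u i ≤ v
    · rw [if_pos h, if_pos (h.trans hvw)]
    · rw [if_neg h]
      split_ifs
      exacts [ha i, le_rfl]
  have hψ0 : ∀ v, 0 ≤ ψ v := fun v => tsum_nonneg fun i => by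
    split_ifs
    exacts [ha i, le_rfl]
  have hlapC : ∀ z : ℂ, 0 < z.re →
      ∫ t in Set.Ioi 0, ((Real.exp (-t) * ψ t : ℝ) : ℂ) * Complex.exp (-z * t) =
        G (1 + z) / (1 + z) := by
    intro z hz
    have hw : 0 < (1 + z).re := by simp; linarith
    have hn : ∀ t : ℝ, ‖Complex.exp (-(1 + z) * t)‖ = Real.exp (-(1 + z.re) * t) := by
      intro t; rw [Complex.norm_exp]; simp
    have hw' : 0 < ((1 + z.re : ℝ) : ℂ).re := by simpa using hw
    have h1 := hasSum_integral_of_summable_integral_norm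
      (F := fun i (t : ℝ) => (if u i ≤ t then (a i : ℂ) else 0) * Complex.exp (-(1 + z) * t))
      (μ := volume.restrict (Set.Ioi 0)) (fun i => integrableOn_indicator_cexp (a i) (u i) hw) (by
        have h2 : ∀ i, ∫ t : ℝ in Set.Ioi 0,
            ‖(if u i ≤ t then (a i : ℂ) else 0) * Complex.exp (-(1 + z) * t)‖ =
            a i * Real.exp (-(1 + z.re) * u i) / (1 + z.re) := by
          intro i
          have h3 := setIntegral_indicator_cexp (a i) (hu i) hw'
          rw [← Complex.ofReal_inj, ← integral_complex_ofReal]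
          convert h3 using 1
          · refine integral_congr_ae (ae_of_all _ fun t => ?_)
            simp only
            rw [norm_mul, hn]
            split_ifs
            · simp [abs_of_nonneg (ha i)]
            · simp
          · push_cast
            rfl
        simp_rw [h2]
        exact (hsum _ (by linarith)).div_const _)
    simp_rw [setIntegral_indicator_cexp _ (hu _) hw] at h1
    rw [← hG _ (by simpa using hz), ← tsum_div_const, h1.tsum_eq]
    refine integral_congr_ae (ae_of_all _ fun t => ?_)
    simp only
    rw [tsum_mul_right, hψ]
    push_cast
    have h4 : ∀ i, ((if u i ≤ t then a i else 0 : ℝ) : ℂ) = if u i ≤ t then (a i : ℂ) else 0 := by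
      intro i; split_ifs <;> simp
    simp_rw [h4]
    have h5 : Complex.exp (-(1 + z) * t) = Complex.exp (-t) * Complex.exp (-z * t) := by
      rw [← Complex.exp_add]; ring_nf
    rw [h5]
    ring
  have hGre : ∀ ε : ℝ, 0 < ε → G (1 + ε) = ((∑' i, a i * Real.exp (-(1 + ε) * u i) : ℝ) : ℂ) := by
    intro ε hε
    rw [← hG _ (by simpa using hε)]
    push_cast
    rfl
  -- The hypotheses only provide limits at the boundary points; `extendFrom` assembles them into a
  -- function continuous on the closed half-plane.
  refine tendsto_of_laplace
    (g := extendFrom {z : ℂ | 0 < z.re} (fun z => G (1 + z) / (1 + z) - A / z))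
    (fun v => mul_nonneg (Real.exp_nonneg _) (hψ0 v))
    ((by fun_prop : Measurable fun v : ℝ => Real.exp (-v)).mul hψmono.measurable) ?_ ?_ ?_ ?_
  · intro v w hvw
    rw [← mul_assoc, ← Real.exp_add, show w - v + -w = -v by ring]
    exact mul_le_mul_of_nonneg_left (hψmono hvw) (Real.exp_nonneg _)
  · intro ε hε
    have hsε := hsum (1 + ε) (by linarith)
    -- Integrability is deduced from the value of the integral: without it the integral would be 0
    -- by convention, while `hlapC` says it equals G(1 + ε)/(1 + ε). If G(1 + ε) does vanish, all
    -- coefficients are zero.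
    by_cases h0 : ∑' i, a i * Real.exp (-(1 + ε) * u i) = 0
    · have h1 := hsε.hasSum
      rw [h0, hasSum_zero_iff_of_nonneg (fun i => mul_nonneg (ha i) (Real.exp_nonneg _))] at h1
      have h2 : ∀ i, a i = 0 := fun i => by
        have := congrFun h1 i
        simpa [Real.exp_ne_zero] using this
      have h3 : ∀ v, ψ v = 0 := fun v => by simp [hψ, h2]
      refine integrableOn_zero.congr_fun (fun v _ => ?_) measurableSet_Ioi
      change 0 = Real.exp (-v) * ψ v * Real.exp (-ε * v)
      rw [h3, mul_zero, zero_mul]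
    · by_contra hni
      have h1 := hlapC ε (by simpa using hε)
      rw [hGre ε hε] at h1
      have h2 : ∫ t in Set.Ioi 0, ((Real.exp (-t) * ψ t : ℝ) : ℂ) * Complex.exp (-(ε : ℂ) * t) =
          ((∫ t in Set.Ioi 0, Real.exp (-t) * ψ t * Real.exp (-ε * t) : ℝ) : ℂ) := by
        rw [← integral_complex_ofReal]
        push_cast
        rfl
      rw [h2, integral_undef hni, Complex.ofReal_zero, eq_comm, div_eq_zero_iff] at h1
      rcases h1 with h1 | h1
      · exact h0 (by exact_mod_cast h1)
      · have := congrArg Complex.re h1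
        simp at this
        linarith
  · refine continuousOn_extendFrom ?_ fun z hz => ?_
    · rw [Complex.closure_setOfPred_lt_re]
    · exact exists_tendsto_sub_div_of_shift hz (hlim _ (by simpa using hz))
  · intro z hz
    obtain ⟨c, hc⟩ := exists_tendsto_sub_div_of_shift (le_of_lt hz)
      (hlim (1 + z) (by simpa using hz.le))
    have hz' : z ∈ {z : ℂ | 0 < z.re} := hz
    have h1 := tendsto_nhds_unique (hc.mono_left (pure_le_nhdsWithin hz')) (tendsto_pure_nhds _ z)
    rw [extendFrom_eq (subset_closure hz') hc, h1, hlapC z hz]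
    ring

end Tauberian

/-! ### Lattice sums, Hecke characters and the series L_k -/

theorem one_le_norm_gaussianInt {ω : GaussianInt} (hω : ω ≠ 0) : 1 ≤ ‖(ω : ℂ)‖ := by
  have h1 : (1 : ℝ) ≤ (ω.norm : ℝ) := by exact_mod_cast GaussianInt.norm_pos.2 hω
  rw [GaussianInt.intCast_real_norm, Complex.normSq_eq_norm_sq] at h1
  nlinarith [norm_nonneg (ω : ℂ)]

/-- Comparison with the sup norm on ℤ², which is dominated by the Euclidean norm; the negative
exponent reverses the inequality. -/
theorem summable_norm_gaussianInt_rpow {r : ℝ} (hr : 2 < r) :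
    Summable fun ω : GaussianInt => ‖(ω : ℂ)‖ ^ (-r) := by
  have h1 := EisensteinSeries.summable_one_div_norm_rpow hr
  have hinj : Function.Injective fun ω : GaussianInt => (![ω.re, ω.im] : Fin 2 → ℤ) := by
    intro a b hab
    have h0 := congrFun hab 0
    have h1 := congrFun hab 1
    simp at h0 h1
    exact Zsqrtd.ext h0 h1
  refine Summable.of_nonneg_of_le (fun ω => by positivity) (fun ω => ?_) (h1.comp_injective hinj)
  simp only [Function.comp]
  rcases eq_or_ne ω 0 with rfl | hω
  · rw [GaussianInt.toComplex_zero, norm_zero, Real.zero_rpow (by linarith)]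
    positivity
  · have hpos : 0 < ‖(![ω.re, ω.im] : Fin 2 → ℤ)‖ := by
      rw [norm_pos_iff]
      intro h
      have h0 := congrFun h 0
      have h1 := congrFun h 1
      simp at h0 h1
      exact hω (Zsqrtd.ext h0 h1)
    refine Real.rpow_le_rpow_of_nonpos hpos ?_ (by linarith)
    refine (pi_norm_le_iff_of_nonneg (norm_nonneg _)).2 fun i => ?_
    fin_cases i
    · simpa [Int.norm_eq_abs] using Complex.abs_re_le_norm (ω : ℂ)
    · simpa [Int.norm_eq_abs] using Complex.abs_im_le_norm (ω : ℂ)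

/-- `log |z| ^ 2`. -/
noncomputable def logSq (z : ℂ) : ℝ := 2 * Real.log ‖z‖

theorem logSq_mul {z w : ℂ} (hz : z ≠ 0) (hw : w ≠ 0) : logSq (z * w) = logSq z + logSq w := by
  rw [logSq, norm_mul, Real.log_mul (by simpa using hz) (by simpa using hw)]
  simp only [logSq]
  ring

theorem logSq_nonneg (ω : GaussianInt) : 0 ≤ logSq ω := by
  rcases eq_or_ne ω 0 with rfl | hω
  · simp [logSq]
  · exact mul_nonneg two_pos.le (Real.log_nonneg (one_le_norm_gaussianInt hω))

theorem exp_mul_logSq {z : ℂ} (hz : z ≠ 0) (x : ℝ) : Real.exp (x * logSq z) = ‖z‖ ^ (2 * x) := by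
  rw [Real.rpow_def_of_pos (norm_pos_iff.2 hz), logSq]
  ring_nf

/-- The completely multiplicative function `z ↦ (z / |z|) ^ k * |z| ^ (-2 s)`, extended by `0`. -/
noncomputable def heckeTerm (k : ℤ) (s z : ℂ) : ℂ :=
  if z = 0 then 0 else (z / ‖z‖) ^ k * Complex.exp (-s * logSq z)

@[simp] theorem heckeTerm_zero (k : ℤ) (s : ℂ) : heckeTerm k s 0 = 0 := by simp [heckeTerm]

theorem heckeTerm_of_ne_zero (k : ℤ) (s : ℂ) {z : ℂ} (hz : z ≠ 0) :
    heckeTerm k s z = (z / ‖z‖) ^ k * Complex.exp (-s * logSq z) := by simp [heckeTerm, hz]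

theorem heckeTerm_mul (k : ℤ) (s z w : ℂ) :
    heckeTerm k s (z * w) = heckeTerm k s z * heckeTerm k s w := by
  rcases eq_or_ne z 0 with rfl | hz
  · simp
  rcases eq_or_ne w 0 with rfl | hw
  · simp
  rw [heckeTerm_of_ne_zero _ _ hz, heckeTerm_of_ne_zero _ _ hw,
    heckeTerm_of_ne_zero _ _ (mul_ne_zero hz hw), logSq_mul hz hw, norm_mul]
  push_cast
  rw [mul_add, Complex.exp_add, mul_div_mul_comm, mul_zpow]
  ring

theorem norm_heckeTerm (k : ℤ) (s : ℂ) {z : ℂ} (hz : z ≠ 0) :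
    ‖heckeTerm k s z‖ = ‖z‖ ^ (-(2 * s.re)) := by
  have h1 : ‖z / (‖z‖ : ℂ)‖ = 1 := by
    rw [norm_div, Complex.norm_real, norm_norm, div_self (by simpa using hz)]
  rw [heckeTerm_of_ne_zero _ _ hz, norm_mul, norm_zpow, h1, one_zpow, one_mul, Complex.norm_exp]
  have h2 : (-s * (logSq z : ℂ)).re = (-s.re) * logSq z := by simp
  rw [h2, exp_mul_logSq hz]
  ring_nf

theorem norm_heckeTerm_le (k : ℤ) {s : ℂ} {σ : ℝ} (hs : σ ≤ s.re) (ω : GaussianInt) :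
    ‖heckeTerm k s ω‖ ≤ ‖(ω : ℂ)‖ ^ (-(2 * σ)) := by
  rcases eq_or_ne ω 0 with rfl | hω
  · simp
    positivity
  · rw [norm_heckeTerm k s (by simpa using hω)]
    exact Real.rpow_le_rpow_of_exponent_le (one_le_norm_gaussianInt hω) (by linarith)

/-- `heckeTerm` varies slowly: its relative change is at most proportional to that of `z`. -/
theorem norm_heckeTerm_add_sub_le (k : ℤ) {s : ℂ} {B : ℝ} (hB : ‖s‖ ≤ B) {z w : ℂ} (hz : z ≠ 0)
    (hw : 2 * ‖w‖ ≤ ‖z‖) :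
    ‖heckeTerm k s (z + w) - heckeTerm k s z‖ ≤
      ‖heckeTerm k s z‖ * ((|k| + 2 * B) * (3 / 2) * Real.exp ((|k| + 2 * B) * (3 / 4)) *
        (‖w‖ / ‖z‖)) := by
  have hz0 : 0 < ‖z‖ := norm_pos_iff.2 hz
  set η := w / z with hη
  have hηn : ‖η‖ = ‖w‖ / ‖z‖ := norm_div _ _
  have hη2 : ‖η‖ ≤ 1 / 2 := by
    rw [hηn, div_le_iff₀ hz0]; linarith
  have hfac : z + w = z * (1 + η) := by rw [hη]; field_simp
  have h1 : (1 + η) ≠ 0 := by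
    intro h
    have : η = -1 := by linear_combination h
    rw [this] at hη2
    norm_num at hη2
  set ℓ := Complex.log (1 + η) with hℓ
  have hℓn : ‖ℓ‖ ≤ 3 / 2 * ‖η‖ := Complex.norm_log_one_add_half_le_self hη2
  -- By multiplicativity only the factor 1 + η matters, and there the term is exp X with X
  -- real-linear in log(1 + η). The constants come from |log(1 + η)| ≤ (3/2)|η|, from |η| ≤ 1/2, and
  -- from |exp X - 1| ≤ |X| exp|X|.
  have h2 : heckeTerm k s (1 + η) = Complex.exp (k * (ℓ.im * Complex.I) - 2 * s * ℓ.re) := by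
    rw [heckeTerm_of_ne_zero _ _ h1, sub_eq_add_neg, Complex.exp_add, Complex.exp_int_mul]
    congr 1
    · congr 1
      rw [hℓ, Complex.log_im, div_eq_iff (by simpa using h1), mul_comm, Complex.norm_mul_exp_arg_mul_I]
    · rw [logSq, hℓ, Complex.log_re]
      push_cast
      ring_nf
  set X := (k : ℂ) * (ℓ.im * Complex.I) - 2 * s * ℓ.re with hX
  have hB0 : 0 ≤ B := (norm_nonneg _).trans hB
  have hXn : ‖X‖ ≤ (|k| + 2 * B) * ‖ℓ‖ := by
    have hk : ‖(k : ℂ)‖ = |k| := by rw [Complex.norm_intCast]; push_cast; rfl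
    have h3 : |ℓ.im| ≤ ‖ℓ‖ := Complex.abs_im_le_norm ℓ
    have h4 : |ℓ.re| ≤ ‖ℓ‖ := Complex.abs_re_le_norm ℓ
    calc ‖X‖ ≤ ‖(k : ℂ) * (ℓ.im * Complex.I)‖ + ‖2 * s * ℓ.re‖ := norm_sub_le _ _
      _ = |k| * |ℓ.im| + 2 * ‖s‖ * |ℓ.re| := by
          rw [norm_mul, norm_mul, norm_mul, norm_mul, hk]; simp
      _ ≤ |k| * ‖ℓ‖ + 2 * B * ‖ℓ‖ := by
          have : (0 : ℝ) ≤ |k| := by positivity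
          gcongr
      _ = _ := by ring
  have hD0 : (0 : ℝ) ≤ |k| + 2 * B := by positivity
  have hX1 : ‖X‖ ≤ (|k| + 2 * B) * (3 / 2) * ‖η‖ := by
    refine hXn.trans ?_
    rw [mul_assoc]
    gcongr
  have hX2 : ‖X‖ ≤ (|k| + 2 * B) * (3 / 4) := by
    refine hX1.trans ?_
    rw [mul_assoc]
    refine mul_le_mul_of_nonneg_left ?_ hD0
    linarith
  rw [hfac, heckeTerm_mul, h2, ← mul_sub_one, norm_mul, ← hηn]
  refine mul_le_mul_of_nonneg_left ?_ (norm_nonneg _)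
  have h5 := Complex.norm_exp_sub_sum_le_norm_mul_exp X 1
  simp only [Finset.range_one, Finset.sum_singleton, pow_zero, Nat.factorial_zero, Nat.cast_one,
    div_one, pow_one] at h5
  calc _ ≤ ‖X‖ * Real.exp ‖X‖ := h5
    _ ≤ (|k| + 2 * B) * (3 / 2) * ‖η‖ * Real.exp ((|k| + 2 * B) * (3 / 4)) := by gcongr
    _ = _ := by ring

theorem hasDerivAt_heckeTerm (k : ℤ) (z s : ℂ) :
    HasDerivAt (fun s => heckeTerm k s z) (-(logSq z) * heckeTerm k s z) s := by
  rcases eq_or_ne z 0 with rfl | hz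
  · simpa using hasDerivAt_const s (0 : ℂ)
  · simp_rw [heckeTerm_of_ne_zero k _ hz]
    have := ((((hasDerivAt_id s).neg).mul_const (logSq z : ℂ)).cexp).const_mul ((z / ‖z‖) ^ k)
    refine this.congr_deriv ?_
    simp
    ring

theorem differentiable_heckeTerm (k : ℤ) (z : ℂ) : Differentiable ℂ fun s => heckeTerm k s z :=
  fun s => (hasDerivAt_heckeTerm k z s).differentiableAt

/-- Four times the Hecke `L`-function of `ℤ[i]` with the character `z ↦ (z / |z|) ^ k`. -/
noncomputable def heckeL (k : ℤ) (s : ℂ) : ℂ := ∑' ω : GaussianInt, heckeTerm k s ω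

theorem summable_norm_heckeTerm (k : ℤ) {s : ℂ} (hs : 1 < s.re) :
    Summable fun ω : GaussianInt => ‖heckeTerm k s ω‖ :=
  Summable.of_nonneg_of_le (fun _ => norm_nonneg _)
    (fun ω => norm_heckeTerm_le k le_rfl ω)
    (summable_norm_gaussianInt_rpow (by linarith : 2 < 2 * s.re))

theorem isOpen_lt_re (σ : ℝ) : IsOpen {s : ℂ | σ < s.re} :=
  isOpen_lt continuous_const Complex.continuous_re

theorem hasSum_deriv_heckeL (k : ℤ) {s : ℂ} (hs : 1 < s.re) :
    HasSum (fun ω : GaussianInt => -(logSq ω) * heckeTerm k s ω) (deriv (heckeL k) s) := by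
  obtain ⟨σ, hσ1, hσ⟩ := exists_between hs
  have h := Complex.hasSum_deriv_of_summable_norm
    (F := fun (ω : GaussianInt) s => heckeTerm k s ω) (U := {s : ℂ | σ < s.re})
    (summable_norm_gaussianInt_rpow (by linarith : 2 < 2 * σ))
    (fun ω => (differentiable_heckeTerm k ω).differentiableOn) (isOpen_lt_re σ)
    (fun ω w hw => norm_heckeTerm_le k (le_of_lt hw) ω) hσ
  simp_rw [fun ω : GaussianInt => (hasDerivAt_heckeTerm k ω s).deriv] at h
  exact h

theorem differentiableOn_heckeL (k : ℤ) : DifferentiableOn ℂ (heckeL k) {s | 1 < s.re} := by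
  intro s hs
  obtain ⟨σ, hσ1, hσ⟩ := exists_between (show 1 < s.re from hs)
  have h := Complex.differentiableOn_tsum_of_summable_norm
    (F := fun (ω : GaussianInt) s => heckeTerm k s ω) (U := {s : ℂ | σ < s.re})
    (summable_norm_gaussianInt_rpow (by linarith : 2 < 2 * σ))
    (fun ω => (differentiable_heckeTerm k ω).differentiableOn) (isOpen_lt_re σ)
    (fun ω w hw => norm_heckeTerm_le k (le_of_lt hw) ω)
  exact (h.differentiableAt ((isOpen_lt_re σ).mem_nhds hσ)).differentiableWithinAt

/-! ### Continuation across Re s = 1 by residue classes -/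

section Residues

variable {R : Type*} [Fintype R]

/-- Sum over all residue classes `r` mod `α` of the differences between `heckeTerm` at `α ω` and
at `α ω + r`; it converges to the left of the line `re s = 1`. -/
noncomputable def heckeDiff (α : GaussianInt) (rep : R → GaussianInt) (k : ℤ) (s : ℂ) : ℂ :=
  ∑' ω : GaussianInt, ∑ r : R,
    (heckeTerm k s (α * ω : GaussianInt) - heckeTerm k s (α * ω + rep r : GaussianInt))

theorem norm_heckeTerm_le_one (k : ℤ) {s : ℂ} (hs : 0 ≤ s.re) (ω : GaussianInt) :
    ‖heckeTerm k s ω‖ ≤ 1 := by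
  rcases eq_or_ne ω 0 with rfl | hω
  · simp
  · rw [norm_heckeTerm k s (by simpa using hω)]
    exact Real.rpow_le_one_of_one_le_of_nonpos (one_le_norm_gaussianInt hω) (by linarith)

/-- A bounded shift changes a term of size |αω|^(-2σ) by O(|αω|^(-2σ-1)), which gains one power. For
σ > 3/4 the exponent is at least 5/2, more than the 2 needed for summation over a planar lattice,
and the bound is locally uniform in s. -/
theorem analyticAt_heckeDiff {α : GaussianInt} (hα : α ≠ 0) (rep : R → GaussianInt) (k : ℤ)
    {s₀ : ℂ} (hs₀ : 3 / 4 < s₀.re) : AnalyticAt ℂ (heckeDiff α rep k) s₀ := by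
  set B := ‖s₀‖ + 1 with hB
  set U := {s : ℂ | 3 / 4 < s.re} ∩ {s : ℂ | ‖s‖ < B} with hU
  have hUo : IsOpen U := (isOpen_lt_re _).inter (isOpen_lt continuous_norm continuous_const)
  obtain ⟨ρ, hρ0, hρ⟩ : ∃ ρ : ℝ, 0 ≤ ρ ∧ ∀ r, ‖(rep r : ℂ)‖ ≤ ρ :=
    ⟨∑ r, ‖(rep r : ℂ)‖, Finset.sum_nonneg fun _ _ => norm_nonneg _, fun r =>
      Finset.single_le_sum (f := fun r => ‖(rep r : ℂ)‖) (fun _ _ => norm_nonneg _)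
        (Finset.mem_univ r)⟩
  set K := (|k| + 2 * B) * (3 / 2) * Real.exp ((|k| + 2 * B) * (3 / 4)) with hK
  have hB0 : 0 ≤ B := by positivity
  have hK0 : 0 ≤ K := by positivity
  -- The slow-variation estimate requires |αω| ≥ 2|r|. The finitely many ω for which this may fail
  -- are bounded trivially by 2.
  set V : Set GaussianInt := {ω | ‖((α * ω : GaussianInt) : ℂ)‖ ^ 2 ≤ (2 * ρ) ^ 2} with hV
  set u : GaussianInt → ℝ := fun ω => K * ρ * ‖((α * ω : GaussianInt) : ℂ)‖ ^ (-(5 / 2) : ℝ) +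
    V.indicator (fun _ => (2 : ℝ)) ω with hu
  have hinj : Function.Injective fun ω : GaussianInt => α * ω := mul_right_injective₀ hα
  have husum : Summable u := by
    refine Summable.add (((summable_norm_gaussianInt_rpow (by norm_num : (2 : ℝ) < 5 / 2)).comp_injective
      hinj).mul_left _) ?_
    refine summable_of_hasFiniteSupport
      (((finite_gaussianDisc ((2 * ρ) ^ 2)).preimage hinj.injOn).subset ?_)
    intro ω hω
    by_contra h
    exact hω (Set.indicator_of_notMem h _)
  have hbound : ∀ (r : R) (ω : GaussianInt), ∀ s ∈ U,
      ‖heckeTerm k s (α * ω : GaussianInt) - heckeTerm k s (α * ω + rep r : GaussianInt)‖ ≤ u ω := by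
    intro r ω s hs
    have hre : 3 / 4 < s.re := hs.1
    have hfirst : 0 ≤ K * ρ * ‖((α * ω : GaussianInt) : ℂ)‖ ^ (-(5 / 2) : ℝ) := by positivity
    by_cases h : ω ∈ V
    · have h1 := norm_heckeTerm_le_one k (by linarith : 0 ≤ s.re) (α * ω)
      have h2 := norm_heckeTerm_le_one k (by linarith : 0 ≤ s.re) (α * ω + rep r)
      have h3 : u ω = K * ρ * ‖((α * ω : GaussianInt) : ℂ)‖ ^ (-(5 / 2) : ℝ) + 2 := by
        rw [hu]
        simp only
        rw [Set.indicator_of_mem h]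
      rw [h3]
      refine (norm_sub_le _ _).trans ?_
      linarith
    · have h3 : u ω = K * ρ * ‖((α * ω : GaussianInt) : ℂ)‖ ^ (-(5 / 2) : ℝ) := by
        rw [hu]
        simp only
        rw [Set.indicator_of_notMem h, add_zero]
      have h4 : 2 * ρ < ‖((α * ω : GaussianInt) : ℂ)‖ := by
        by_contra! h5
        have h6 : ‖((α * ω : GaussianInt) : ℂ)‖ ^ 2 ≤ (2 * ρ) ^ 2 := by gcongr
        exact h h6
      have hpos : 0 < ‖((α * ω : GaussianInt) : ℂ)‖ := by linarith
      have hz : ((α * ω : GaussianInt) : ℂ) ≠ 0 := norm_pos_iff.1 hpos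
      have h5 := norm_heckeTerm_add_sub_le k (le_of_lt hs.2) hz (w := (rep r : ℂ))
        (by linarith [hρ r])
      rw [h3, norm_sub_rev, GaussianInt.toComplex_add]
      refine h5.trans ?_
      have h6 := norm_heckeTerm_le k hre.le (α * ω)
      have h7 : ‖((α * ω : GaussianInt) : ℂ)‖ ^ (-(5 / 2) : ℝ) =
          ‖((α * ω : GaussianInt) : ℂ)‖ ^ (-(2 * (3 / 4)) : ℝ) * ‖((α * ω : GaussianInt) : ℂ)‖⁻¹ := by
        rw [← Real.rpow_neg_one, ← Real.rpow_add hpos]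
        norm_num
      rw [h7, ← hK]
      calc _ ≤ ‖((α * ω : GaussianInt) : ℂ)‖ ^ (-(2 * (3 / 4)) : ℝ) *
            (K * (ρ / ‖((α * ω : GaussianInt) : ℂ)‖)) := by
            gcongr
            exact hρ r
        _ = _ := by rw [div_eq_mul_inv]; ring
  have hdiff := Complex.differentiableOn_tsum_of_summable_norm
    (F := fun (ω : GaussianInt) s => ∑ r : R, (heckeTerm k s (α * ω : GaussianInt) -
      heckeTerm k s (α * ω + rep r : GaussianInt))) (U := U) (husum.mul_left (Fintype.card R : ℝ))
    (fun ω => (Differentiable.fun_sum fun r _ => (differentiable_heckeTerm k _).sub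
      (differentiable_heckeTerm k _)).differentiableOn) hUo
    (fun ω s hs => by
      refine (norm_sum_le _ _).trans ?_
      refine (Finset.sum_le_sum fun r _ => hbound r ω s hs).trans ?_
      simp)
  refine hdiff.analyticAt (hUo.mem_nhds ⟨hs₀, ?_⟩)
  change ‖s₀‖ < B
  linarith

/-- Summing f(αω) over ω and r gives |R| f(α) L_k by multiplicativity, while the terms f(αω + r)
enumerate ℤ[i] once and give L_k. -/
theorem heckeDiff_eq {α : GaussianInt} {rep : R → GaussianInt}
    (hα : Function.Bijective fun p : GaussianInt × R => α * p.1 + rep p.2) (k : ℤ) {s : ℂ}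
    (hs : 1 < s.re) :
    heckeDiff α rep k s = (Fintype.card R * heckeTerm k s α - 1) * heckeL k s := by
  have hsum : Summable fun ω : GaussianInt => heckeTerm k s ω := (summable_norm_heckeTerm k hs).of_norm
  have h1 : Summable fun p : GaussianInt × R => heckeTerm k s (α * p.1 + rep p.2 : GaussianInt) :=
    ((Equiv.ofBijective _ hα).summable_iff (f := fun ω : GaussianInt => heckeTerm k s ω)).2 hsum
  have h2 : heckeL k s = ∑' ω : GaussianInt, ∑ r : R, heckeTerm k s (α * ω + rep r : GaussianInt) := by
    have h5 := (Equiv.ofBijective _ hα).tsum_eq fun ω : GaussianInt => heckeTerm k s ω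
    simp only [Equiv.ofBijective_apply] at h5
    rw [heckeL, ← h5, h1.tsum_prod]
    simp_rw [tsum_fintype]
  have h3 : Summable fun ω : GaussianInt => ∑ r : R, heckeTerm k s (α * ω + rep r : GaussianInt) := by
    have := h1.prod
    simp_rw [tsum_fintype] at this
    exact this
  have h4 : ∀ ω : GaussianInt, ∑ _r : R, heckeTerm k s (α * ω : GaussianInt) =
      (Fintype.card R * heckeTerm k s α) * heckeTerm k s ω := by
    intro ω
    rw [Finset.sum_const, GaussianInt.toComplex_mul, heckeTerm_mul, nsmul_eq_mul, Finset.card_univ]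
    ring
  rw [heckeDiff]
  simp_rw [Finset.sum_sub_distrib, h4]
  rw [(hsum.mul_left _).tsum_sub h3, tsum_mul_left, ← h2, ← heckeL]
  ring

end Residues

/-! ### Complete residue systems modulo n and modulo 2 + i -/

/-- The Gaussian integer `a + b i` with `0 ≤ a, b < n`. -/
def gridRep (n : ℕ) (r : Fin n × Fin n) : GaussianInt := ⟨(r.1 : ℕ), (r.2 : ℕ)⟩

theorem bijective_gridRep {n : ℕ} (hn : 0 < n) :
    Function.Bijective fun p : GaussianInt × (Fin n × Fin n) =>
      (n : GaussianInt) * p.1 + gridRep n p.2 := by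
  have hre : ∀ p : GaussianInt × (Fin n × Fin n),
      ((n : GaussianInt) * p.1 + gridRep n p.2).re = n * p.1.re + (p.2.1 : ℕ) := by
    intro p; simp [gridRep]
  have him : ∀ p : GaussianInt × (Fin n × Fin n),
      ((n : GaussianInt) * p.1 + gridRep n p.2).im = n * p.1.im + (p.2.2 : ℕ) := by
    intro p; simp [gridRep]
  have hn' : (0 : ℤ) < n := by exact_mod_cast hn
  have key : ∀ (x y : ℤ) (a b : Fin n), n * x + ((a : ℕ) : ℤ) = n * y + ((b : ℕ) : ℤ) →
      x = y ∧ a = b := by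
    intro x y a b h
    have ha : ((a : ℕ) : ℤ) < n := by exact_mod_cast a.2
    have hb : ((b : ℕ) : ℤ) < n := by exact_mod_cast b.2
    have h1 : x = y := by
      have := congrArg (· / (n : ℤ)) h
      simpa [Int.mul_add_ediv_left _ _ hn'.ne', Int.ediv_eq_zero_of_lt, ha, hb] using this
    subst h1
    refine ⟨rfl, Fin.ext ?_⟩
    have := add_left_cancel h
    exact_mod_cast this
  constructor
  · intro p q h
    have h1 := congrArg Zsqrtd.re h
    have h2 := congrArg Zsqrtd.im h
    simp only [hre, him] at h1 h2
    obtain ⟨h3, h4⟩ := key _ _ _ _ h1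
    obtain ⟨h5, h6⟩ := key _ _ _ _ h2
    exact Prod.ext (Zsqrtd.ext h3 h5) (Prod.ext h4 h6)
  · intro ω
    have hm : ∀ x : ℤ, ((x % n).toNat : ℤ) = x % n := fun x =>
      Int.toNat_of_nonneg (Int.emod_nonneg _ hn'.ne')
    have hl : ∀ x : ℤ, (x % n).toNat < n := fun x => by
      have := Int.emod_lt_of_pos x hn'
      have := hm x
      omega
    refine ⟨(⟨ω.re / n, ω.im / n⟩, ⟨_, hl ω.re⟩, ⟨_, hl ω.im⟩), Zsqrtd.ext ?_ ?_⟩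
    · rw [hre]; simp only [hm]; exact Int.mul_ediv_add_emod _ _
    · rw [him]; simp only [hm]; exact Int.mul_ediv_add_emod _ _

theorem bijective_two_add_I_mul_add :
    Function.Bijective fun p : GaussianInt × Fin 5 =>
      (⟨2, 1⟩ : GaussianInt) * p.1 + ((p.2 : ℕ) : GaussianInt) := by
  have hre : ∀ p : GaussianInt × Fin 5,
      ((⟨2, 1⟩ : GaussianInt) * p.1 + ((p.2 : ℕ) : GaussianInt)).re =
        2 * p.1.re - p.1.im + (p.2 : ℕ) := by
    intro p; simp; ring
  have him : ∀ p : GaussianInt × Fin 5,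
      ((⟨2, 1⟩ : GaussianInt) * p.1 + ((p.2 : ℕ) : GaussianInt)).im = p.1.re + 2 * p.1.im := by
    intro p; simp; ring
  constructor
  · intro p q h
    have h1 := congrArg Zsqrtd.re h
    have h2 := congrArg Zsqrtd.im h
    simp only [hre, him] at h1 h2
    have hp := p.2.2
    have hq := q.2.2
    refine Prod.ext (Zsqrtd.ext ?_ ?_) (Fin.ext ?_) <;> omega
  · intro ω
    -- Since i ≡ -2 modulo 2 + i, the residue of a + bi is a - 2b modulo 5. The quotient is obtained
    -- by multiplying ω minus this residue by 2 - i and dividing by 5.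
    have hl : ((ω.re - 2 * ω.im) % 5).toNat < 5 := by omega
    have hm : (((ω.re - 2 * ω.im) % 5).toNat : ℤ) = (ω.re - 2 * ω.im) % 5 := by omega
    refine ⟨(⟨(2 * (ω.re - (ω.re - 2 * ω.im) % 5) + ω.im) / 5,
      (2 * ω.im - (ω.re - (ω.re - 2 * ω.im) % 5)) / 5⟩, ⟨_, hl⟩), Zsqrtd.ext ?_ ?_⟩
    · rw [hre]; simp only [hm]; omega
    · rw [him]; simp only; omega

/-! ### The order of L_{4h} at points of the line Re s = 1 -/

theorem gaussianInt_pow_four_of_norm_eq_one {ω : GaussianInt} (hω : ω.norm = 1) : ω ^ 4 = 1 := by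
  rw [Zsqrtd.norm_def] at hω
  obtain ⟨a, b⟩ := ω
  simp only at hω
  have ha : a * a ≤ 1 := by nlinarith [mul_self_nonneg b]
  have hb : b * b ≤ 1 := by nlinarith [mul_self_nonneg a]
  have ha1 : -1 ≤ a := by nlinarith
  have ha2 : a ≤ 1 := by nlinarith
  have hb1 : -1 ≤ b := by nlinarith
  have hb2 : b ≤ 1 := by nlinarith
  interval_cases a <;> interval_cases b <;> first | omega | decide

theorem norm_toComplex_eq_one_iff {ω : GaussianInt} : ‖(ω : ℂ)‖ = 1 ↔ ω.norm = 1 := by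
  have h := GaussianInt.intCast_real_norm ω
  rw [Complex.normSq_eq_norm_sq] at h
  constructor
  · intro h1
    rw [h1] at h
    exact_mod_cast (by simpa using h : (ω.norm : ℝ) = 1)
  · intro h1
    rw [h1] at h
    push_cast at h
    nlinarith [norm_nonneg (ω : ℂ)]

/-- This is where frequencies divisible by 4 matter: units are fourth roots of unity, so they
contribute without cancellation. -/
theorem heckeTerm_of_norm_eq_one (h : ℤ) (s : ℂ) {ω : GaussianInt} (hω : ‖(ω : ℂ)‖ = 1) :
    heckeTerm (4 * h) s ω = 1 := by
  have h0 : (ω : ℂ) ≠ 0 := by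
    intro h0
    rw [h0, norm_zero] at hω
    exact zero_ne_one hω
  have h4 : (ω : ℂ) ^ 4 = 1 := by
    rw [← map_pow, gaussianInt_pow_four_of_norm_eq_one (norm_toComplex_eq_one_iff.1 hω), map_one]
  have h5 : (ω : ℂ) ^ (4 : ℤ) = 1 := by exact_mod_cast h4
  rw [heckeTerm_of_ne_zero _ _ h0, logSq, hω]
  simp [zpow_mul, h5]

/-- `heckeL` is not identically zero far to the right. -/
theorem tendsto_heckeL_atTop (h : ℤ) : ∃ c : ℂ, c ≠ 0 ∧
    Tendsto (fun σ : ℝ => heckeL (4 * h) σ) atTop (𝓝 c) := by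
  classical
  -- As σ grows all terms with |ω| > 1 die out and each unit contributes 1, so the limit is the
  -- number of units.
  set f : GaussianInt → ℝ := fun ω => if ‖(ω : ℂ)‖ = 1 then 1 else 0 with hf
  have hfs : Summable f := by
    refine summable_of_hasFiniteSupport ((finite_gaussianDisc 1).subset fun ω hω => ?_)
    have h1 : ‖(ω : ℂ)‖ = 1 := by
      by_contra h1
      exact hω (if_neg h1)
    change ‖(ω : ℂ)‖ ^ 2 ≤ 1
    rw [h1]
    norm_num
  have hpos : 0 < ∑' ω, f ω := by
    refine hfs.tsum_pos (fun ω => ?_) 1 (by simp [hf])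
    simp only [hf]
    split_ifs <;> norm_num
  refine ⟨∑' ω, (f ω : ℂ), by rw [← Complex.ofReal_tsum]; exact_mod_cast hpos.ne', ?_⟩
  refine tendsto_tsum_of_dominated_convergence
    (summable_norm_gaussianInt_rpow (by norm_num : (2 : ℝ) < 4)) (fun ω => ?_) ?_
  · by_cases hω : ‖(ω : ℂ)‖ = 1
    · simp only [hf, if_pos hω, heckeTerm_of_norm_eq_one h _ hω]
      simp
    · simp only [hf, if_neg hω, Complex.ofReal_zero]
      rcases eq_or_ne ω 0 with rfl | h0
      · simp
      have h1 : 1 < ‖(ω : ℂ)‖ := lt_of_le_of_ne (one_le_norm_gaussianInt h0) (Ne.symm hω)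
      rw [tendsto_zero_iff_norm_tendsto_zero]
      have h0' : (ω : ℂ) ≠ 0 := by simpa using h0
      simp_rw [norm_heckeTerm _ _ h0', Complex.ofReal_re]
      have h2 : Tendsto (fun σ : ℝ => -(2 * σ)) atTop atBot :=
        tendsto_neg_atTop_atBot.comp (tendsto_id.const_mul_atTop two_pos)
      exact (tendsto_rpow_atBot_of_base_gt_one _ h1).comp h2
  · filter_upwards [eventually_ge_atTop 2] with σ hσ ω
    refine (norm_heckeTerm_le (4 * h) (σ := 2) (by simpa using hσ) ω).trans (le_of_eq ?_)
    norm_num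

theorem mem_closure_lt_re {s : ℂ} (hs : 1 ≤ s.re) : s ∈ closure {s : ℂ | 1 < s.re} := by
  rw [Complex.closure_setOfPred_lt_re]
  exact hs

/-- Excludes infinite order at a boundary point: by the identity theorem the series would vanish on
the whole half-plane, against its nonzero limit at +∞. -/
theorem not_eventually_heckeL_eq_zero (h : ℤ) {s₀ : ℂ} (hs₀ : 1 ≤ s₀.re) :
    ¬ ∀ᶠ s in 𝓝[{s | 1 < s.re}] s₀, heckeL (4 * h) s = 0 := by
  intro hev
  have : (𝓝[{s : ℂ | 1 < s.re}] s₀).NeBot := mem_closure_iff_nhdsWithin_neBot.1 (mem_closure_lt_re hs₀)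
  obtain ⟨s₁, h1, h2⟩ := ((eventually_eventually_nhdsWithin.2 hev).and
    eventually_mem_nhdsWithin).exists
  rw [(isOpen_lt_re 1).nhdsWithin_eq h2] at h1
  have han : AnalyticOnNhd ℂ (heckeL (4 * h)) {s | 1 < s.re} :=
    (differentiableOn_heckeL (4 * h)).analyticOnNhd (isOpen_lt_re 1)
  have hz := han.eqOn_zero_of_preconnected_of_eventuallyEq_zero
    (convex_halfSpace_re_gt 1).isPreconnected h2 h1
  obtain ⟨c, hc, ht⟩ := tendsto_heckeL_atTop h
  refine hc (tendsto_nhds_unique ht (tendsto_const_nhds.congr' ?_))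
  filter_upwards [eventually_gt_atTop 1] with σ hσ
  exact (hz (show 1 < (σ : ℂ).re by simpa using hσ)).symm

/-- `heckeL k`, restricted to `1 < re s`, has order `n` at `s₀`. -/
def HasHeckeOrder (k : ℤ) (s₀ : ℂ) (n : ℤ) : Prop :=
  ∃ g : ℂ → ℂ, AnalyticAt ℂ g s₀ ∧ g s₀ ≠ 0 ∧
    ∀ᶠ s in 𝓝[{s | 1 < s.re}] s₀, heckeL k s = (s - s₀) ^ n * g s

theorem hasHeckeOrder_of_analyticAt (h : ℤ) {s₀ : ℂ} (hs₀ : 1 ≤ s₀.re) {f : ℂ → ℂ}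
    (hf : AnalyticAt ℂ f s₀) (hL : ∀ᶠ s in 𝓝[{s | 1 < s.re}] s₀, heckeL (4 * h) s = f s) :
    ∃ n : ℕ, HasHeckeOrder (4 * h) s₀ n := by
  have hne : ¬ ∀ᶠ s in 𝓝 s₀, f s = 0 := by
    intro hev
    refine not_eventually_heckeL_eq_zero h hs₀ ?_
    filter_upwards [hL, hev.filter_mono nhdsWithin_le_nhds] with s h1 h2
    rw [h1, h2]
  obtain ⟨n, g, hg, hg0, hfg⟩ := hf.exists_eventuallyEq_pow_smul_nonzero_iff.2 hne
  refine ⟨n, g, hg, hg0, ?_⟩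
  filter_upwards [hL, hfg.filter_mono nhdsWithin_le_nhds] with s h1 h2
  rw [h1, h2, smul_eq_mul, zpow_natCast]

theorem analyticAt_heckeTerm (k : ℤ) (z s : ℂ) : AnalyticAt ℂ (fun s => heckeTerm k s z) s :=
  (differentiable_heckeTerm k z).analyticAt s

/-- Where the factor |R| f(α) - 1 is nonzero, dividing `heckeDiff` by it continues the series
analytically, so its order is a natural number. -/
theorem exists_hasHeckeOrder_of_residues {R : Type*} [Fintype R] {α : GaussianInt} (hα0 : α ≠ 0)
    {rep : R → GaussianInt}
    (hα : Function.Bijective fun p : GaussianInt × R => α * p.1 + rep p.2) (h : ℤ) {s₀ : ℂ}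
    (hs₀ : 1 ≤ s₀.re) (hne : Fintype.card R * heckeTerm (4 * h) s₀ α ≠ 1) :
    ∃ n : ℕ, HasHeckeOrder (4 * h) s₀ n := by
  have hc : AnalyticAt ℂ (fun s => Fintype.card R * heckeTerm (4 * h) s α - 1) s₀ :=
    (analyticAt_const.mul (analyticAt_heckeTerm _ _ _)).sub analyticAt_const
  have hc0 : Fintype.card R * heckeTerm (4 * h) s₀ α - 1 ≠ 0 := sub_ne_zero.2 hne
  refine hasHeckeOrder_of_analyticAt h hs₀
    ((analyticAt_heckeDiff hα0 rep (4 * h) (by linarith)).div hc hc0) ?_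
  filter_upwards [eventually_mem_nhdsWithin,
    (hc.continuousAt.eventually_ne hc0).filter_mono nhdsWithin_le_nhds] with s hs h1
  rw [Pi.div_apply, heckeDiff_eq hα _ hs, mul_div_cancel_left₀ _ h1]

theorem heckeTerm_natCast (k : ℤ) (s : ℂ) {n : ℕ} (hn : n ≠ 0) :
    heckeTerm k s (n : GaussianInt) = Complex.exp (-s * (2 * Real.log n : ℝ)) := by
  have h1 : ((n : GaussianInt) : ℂ) = n := map_natCast _ n
  have h2 : (n : ℂ) ≠ 0 := by exact_mod_cast hn
  rw [h1, heckeTerm_of_ne_zero _ _ h2, logSq]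
  simp [h2]

/-- For α = n there are n² residues, and the factor |R| f(α) at 1 + it is the pure phase n^(-2it).
-/
theorem natCast_sq_mul_exp {n : ℕ} (hn : n ≠ 0) (t : ℝ) :
    ((n * n : ℕ) : ℂ) * Complex.exp (-(1 + t * Complex.I) * (2 * Real.log n : ℝ)) =
      Complex.exp (-(2 * t * Real.log n : ℝ) * Complex.I) := by
  have hn' : (0 : ℝ) < n := by positivity
  have h1 : ((n * n : ℕ) : ℂ) = Complex.exp ((2 * Real.log n : ℝ) : ℂ) := by
    rw [← Complex.ofReal_exp, two_mul, Real.exp_add, Real.exp_log hn']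
    push_cast
    rfl
  rw [h1, ← Complex.exp_add]
  congr 1
  push_cast
  ring

/-- Both 2t log 2 and 2t log 3 would be integer multiples of 2π. For t ≠ 0 this yields a relation
2^b = 3^a with b > 0, which parity forbids. -/
theorem eq_zero_of_exp_log_eq_one {t : ℝ}
    (h2 : Complex.exp (-(2 * t * Real.log (2 : ℕ) : ℝ) * Complex.I) = 1)
    (h3 : Complex.exp (-(2 * t * Real.log (3 : ℕ) : ℝ) * Complex.I) = 1) : t = 0 := by
  have key : ∀ x : ℝ, Complex.exp (-(x : ℝ) * Complex.I) = 1 → ∃ n : ℤ, x = n * (2 * Real.pi) := by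
    intro x hx
    obtain ⟨n, hn⟩ := Complex.exp_eq_one_iff.1 hx
    refine ⟨-n, ?_⟩
    have h4 : (-(x : ℂ)) = n * (2 * Real.pi) := by
      apply mul_right_cancel₀ Complex.I_ne_zero
      rw [hn]
      ring
    have h5 : -x = n * (2 * Real.pi) := by exact_mod_cast h4
    push_cast
    linarith
  obtain ⟨a, ha⟩ := key _ h2
  obtain ⟨b, hb⟩ := key _ h3
  by_contra ht
  have hpi := Real.pi_pos
  have hl2 : 0 < Real.log (2 : ℕ) := Real.log_pos (by norm_num)
  have hl3 : 0 < Real.log (3 : ℕ) := Real.log_pos (by norm_num)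
  have h1 : (b : ℝ) * Real.log (2 : ℕ) = a * Real.log (3 : ℕ) := by
    have h5 : (2 * t * (2 * Real.pi)) * ((b : ℝ) * Real.log (2 : ℕ) - a * Real.log (3 : ℕ)) = 0 := by
      linear_combination (-(2 * t) * Real.log (2 : ℕ)) * hb + (2 * t * Real.log (3 : ℕ)) * ha
    have h6 : 2 * t * (2 * Real.pi) ≠ 0 := by positivity
    have := (mul_eq_zero.1 h5).resolve_left h6
    linarith
  have hb0 : b ≠ 0 := by
    rintro rfl
    have : 2 * t * Real.log (3 : ℕ) ≠ 0 := by positivity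
    rw [Int.cast_zero, zero_mul] at hb
    exact this hb
  have h5 : (b.natAbs : ℝ) * Real.log (2 : ℕ) = a.natAbs * Real.log (3 : ℕ) := by
    have := congrArg abs h1
    rw [abs_mul, abs_mul, abs_of_pos hl2, abs_of_pos hl3] at this
    rw [Nat.cast_natAbs, Nat.cast_natAbs]
    push_cast
    exact this
  rw [← Real.log_pow, ← Real.log_pow] at h5
  have h6 := Real.log_injOn_pos (by simp) (by simp) h5
  have h7 : 2 ^ b.natAbs = 3 ^ a.natAbs := by exact_mod_cast h6
  have h8 : 2 ∣ 3 ^ a.natAbs := h7 ▸ dvd_pow_self 2 (by simpa using hb0)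
  have := Nat.prime_two.dvd_of_dvd_pow h8
  omega

theorem prime_two_add_I : Prime (⟨2, 1⟩ : GaussianInt) := by
  rw [← irreducible_iff_prime]
  constructor
  · rw [← Zsqrtd.norm_eq_one_iff]
    decide
  · intro a b hab
    have h1 : a.norm.natAbs * b.norm.natAbs = 5 := by
      rw [← Int.natAbs_mul, ← Zsqrtd.norm_mul, ← hab]
      decide
    rw [← Zsqrtd.norm_eq_one_iff, ← Zsqrtd.norm_eq_one_iff]
    have h2 : a.norm.natAbs ∣ 5 := ⟨_, h1.symm⟩
    rcases (Nat.dvd_prime (by norm_num)).1 h2 with h3 | h3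
    · exact Or.inl h3
    · rw [h3] at h1
      right
      omega

theorem two_add_I_pow_ne {n : ℕ} (hn : n ≠ 0) :
    (⟨2, 1⟩ : GaussianInt) ^ n ≠ (⟨2, -1⟩ : GaussianInt) ^ n := by
  intro h
  have h1 : (⟨2, 1⟩ : GaussianInt) ∣ ⟨2, -1⟩ :=
    prime_two_add_I.dvd_of_dvd_pow (h ▸ dvd_pow_self _ hn)
  obtain ⟨c, hc⟩ := h1
  have h2 := congrArg Zsqrtd.re hc
  have h3 := congrArg Zsqrtd.im hc
  simp at h2 h3
  omega

/-- Equality would give (2 + i)^(4|h|) = 5^(2|h|). Cancelling with 5 = (2 + i)(2 - i) leaves (2 +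
i)^(2|h|) = (2 - i)^(2|h|), which is impossible because 2 + i is a prime not dividing 2 - i. -/
theorem five_mul_heckeTerm_two_add_I_ne_one {h : ℤ} (hh : h ≠ 0) :
    5 * heckeTerm (4 * h) 1 (⟨2, 1⟩ : GaussianInt) ≠ 1 := by
  set w : ℂ := ((⟨2, 1⟩ : GaussianInt) : ℂ) with hw
  have hwv : w = 2 + Complex.I := by simp [hw, GaussianInt.toComplex_def]
  have hw0 : w ≠ 0 := by rw [hw]; simp [Zsqrtd.ext_iff]
  have hn : ‖w‖ ^ 2 = 5 := by
    rw [← Complex.normSq_eq_norm_sq, hwv, Complex.normSq_apply]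
    norm_num
  have he : Complex.exp (-1 * logSq w) = 1 / 5 := by
    have h1 : Real.exp (-1 * logSq w) = 1 / 5 := by
      rw [exp_mul_logSq hw0]
      rw [show (2 * (-1) : ℝ) = -(2 : ℕ) by norm_num, Real.rpow_neg (norm_nonneg _),
        Real.rpow_natCast, hn]
      norm_num
    have := congrArg (fun x : ℝ => (x : ℂ)) h1
    push_cast at this ⊢
    exact this
  rw [heckeTerm_of_ne_zero _ _ hw0, he]
  intro h1
  have h2 : (w / ‖w‖) ^ (4 * h) = 1 := by linear_combination h1
  have h3 : (w / ‖w‖) ^ (4 * h.natAbs) = 1 := by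
    rcases Int.natAbs_eq h with h4 | h4
    · rw [h4] at h2
      exact_mod_cast h2
    · rw [h4, mul_neg, zpow_neg, inv_eq_one] at h2
      exact_mod_cast h2
  set m := h.natAbs with hm
  have hm0 : 2 * m ≠ 0 := by
    have : h.natAbs ≠ 0 := by simpa using hh
    omega
  have hn0 : (‖w‖ : ℂ) ≠ 0 := by simpa using hw0
  have h5 : w ^ (2 * (2 * m)) = (5 : ℂ) ^ (2 * m) := by
    have h6 : (‖w‖ : ℂ) ^ 2 = 5 := by exact_mod_cast hn
    rw [← mul_assoc, show 2 * 2 = 4 by norm_num]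
    rw [div_pow, div_eq_one_iff_eq (pow_ne_zero _ hn0)] at h3
    rw [h3, show 4 * m = 2 * (2 * m) by ring, pow_mul, h6]
  have h7 : (5 : ℂ) = w * ((⟨2, -1⟩ : GaussianInt) : ℂ) := by
    rw [hw, ← GaussianInt.toComplex_mul]
    have : (⟨2, 1⟩ : GaussianInt) * ⟨2, -1⟩ = 5 := by decide
    rw [this]
    exact (map_ofNat GaussianInt.toComplex 5).symm
  rw [h7, mul_pow, two_mul (2 * m), pow_add] at h5
  have h8 := mul_left_cancel₀ (pow_ne_zero _ hw0) h5
  refine two_add_I_pow_ne hm0 (GaussianInt.toComplex_injective ?_)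
  rw [map_pow, map_pow]
  exact h8

/-- `heckeL (4 h)` has no pole at `1 + i t`, unless `h = t = 0`. -/
theorem exists_hasHeckeOrder {h : ℤ} {t : ℝ} (hht : h ≠ 0 ∨ t ≠ 0) :
    ∃ n : ℕ, HasHeckeOrder (4 * h) (1 + t * Complex.I) n := by
  have hre : (1 : ℝ) ≤ (1 + t * Complex.I : ℂ).re := by simp
  have grid : ∀ n : ℕ, n ≠ 0 → Complex.exp (-(2 * t * Real.log n : ℝ) * Complex.I) ≠ 1 →
      ∃ m : ℕ, HasHeckeOrder (4 * h) (1 + t * Complex.I) m := by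
    intro n hn hne
    refine exists_hasHeckeOrder_of_residues (by exact_mod_cast hn)
      (bijective_gridRep (Nat.pos_of_ne_zero hn)) h hre ?_
    rw [heckeTerm_natCast _ _ hn, Fintype.card_prod, Fintype.card_fin, natCast_sq_mul_exp hn]
    exact hne
  by_cases ht : t = 0
  · subst ht
    have hh : h ≠ 0 := hht.resolve_right (by simp)
    refine exists_hasHeckeOrder_of_residues (α := ⟨2, 1⟩)
      (rep := fun r : Fin 5 => ((r : ℕ) : GaussianInt)) (by simp [Zsqrtd.ext_iff])
      bijective_two_add_I_mul_add h hre ?_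
    have := five_mul_heckeTerm_two_add_I_ne_one hh
    simpa using this
  · by_cases h2 : Complex.exp (-(2 * t * Real.log (2 : ℕ) : ℝ) * Complex.I) = 1
    · by_cases h3 : Complex.exp (-(2 * t * Real.log (3 : ℕ) : ℝ) * Complex.I) = 1
      · exact absurd (eq_zero_of_exp_log_eq_one h2 h3) ht
      · exact grid 3 (by norm_num) h3
    · exact grid 2 (by norm_num) h2

/-- In the sector 0 ≤ b < a, the column a = m + 1 holds m + 1 points with |a + bi|² ≤ 2(m + 1)². It
contributes at least 1/(2(m + 1)), and the harmonic series diverges. -/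
theorem not_summable_norm_gaussianInt_rpow :
    ¬ Summable fun ω : GaussianInt => ‖(ω : ℂ)‖ ^ (-2 : ℝ) := by
  intro hs
  have hinj : Function.Injective fun p : (m : ℕ) × Fin (m + 1) =>
      (⟨(p.1 + 1 : ℕ), (p.2 : ℕ)⟩ : GaussianInt) := by
    rintro ⟨m, a⟩ ⟨n, b⟩ h
    simp only [Zsqrtd.mk.injEq] at h
    obtain ⟨h1, h2⟩ := h
    have h3 : m = n := by omega
    subst h3
    have h4 : a = b := Fin.ext (by omega)
    rw [h4]
  have h1 := (summable_sigma_of_nonneg fun p => Real.rpow_nonneg (norm_nonneg _) _).1 (hs.comp_injective hinj)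
  have h2 : Summable fun m : ℕ => 1 / ((m + 1 : ℕ) : ℝ) := by
    refine Summable.of_nonneg_of_le (fun m => by positivity) (fun m => ?_) (h1.2.mul_left 2)
    rw [tsum_fintype]
    have h3 : ∀ a : Fin (m + 1), 1 / (2 * ((m + 1 : ℕ) : ℝ) ^ 2) ≤
        ‖((⟨(m + 1 : ℕ), (a : ℕ)⟩ : GaussianInt) : ℂ)‖ ^ (-2 : ℝ) := by
      intro a
      rw [show (-2 : ℝ) = -(2 : ℕ) by norm_num, Real.rpow_neg (norm_nonneg _), Real.rpow_natCast,
        ← Complex.normSq_eq_norm_sq, ← one_div, Complex.normSq_apply, GaussianInt.re_toComplex,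
        GaussianInt.im_toComplex]
      have ha : ((a : ℕ) : ℝ) ≤ (m + 1 : ℕ) := by exact_mod_cast a.2.le
      refine one_div_le_one_div_of_le ?_ ?_
      · push_cast
        positivity
      · have ha0 : (0 : ℝ) ≤ ((a : ℕ) : ℝ) := by positivity
        simp only [Int.cast_natCast]
        nlinarith
    calc 1 / ((m + 1 : ℕ) : ℝ) = 2 * ∑ _a : Fin (m + 1), 1 / (2 * ((m + 1 : ℕ) : ℝ) ^ 2) := by
          rw [Finset.sum_const, Finset.card_univ, Fintype.card_fin, nsmul_eq_mul]
          field_simp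
      _ ≤ _ := mul_le_mul_of_nonneg_left (Finset.sum_le_sum fun a _ => h3 a) two_pos.le
  exact Real.not_summable_one_div_natCast ((summable_nat_add_iff 1).1 h2)

/-- `heckeL 0` is unbounded near `1`. -/
theorem not_eventually_norm_heckeL_zero_le (M : ℝ) :
    ¬ ∀ᶠ s in 𝓝[{s | 1 < s.re}] (1 : ℂ), ‖heckeL 0 s‖ ≤ M := by
  intro hev
  have ht : Tendsto (fun σ : ℝ => (σ : ℂ)) (𝓝[>] 1) (𝓝[{s | 1 < s.re}] (1 : ℂ)) := by
    refine tendsto_nhdsWithin_iff.2 ⟨?_, eventually_mem_nhdsWithin.mono fun σ hσ => ?_⟩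
    · exact (Complex.continuous_ofReal.tendsto' 1 1 (by simp)).mono_left nhdsWithin_le_nhds
    · simpa using hσ
  have hev' := (ht.eventually hev).and eventually_mem_nhdsWithin
  -- All terms are nonnegative for real σ, so each finite partial sum is at most M; letting σ ↓ 1
  -- would bound the partial sums of a divergent series.
  refine not_summable_norm_gaussianInt_rpow (summable_of_sum_le (c := M)
    (fun ω => by positivity) fun F => ?_)
  have hterm : ∀ (σ : ℝ) (ω : GaussianInt), 0 < σ →
      heckeTerm 0 σ ω = (‖(ω : ℂ)‖ ^ (-(2 * σ)) : ℝ) := by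
    intro σ ω hσ
    rcases eq_or_ne ω 0 with rfl | hω
    · simp [Real.zero_rpow (by linarith : -(2 * σ) ≠ 0)]
    · have hω' : (ω : ℂ) ≠ 0 := by simpa using hω
      rw [heckeTerm_of_ne_zero _ _ hω', show -(2 * σ) = 2 * (-σ) by ring, ← exp_mul_logSq hω']
      simp
  have hle : ∀ᶠ σ : ℝ in 𝓝[>] 1, ∑ ω ∈ F, ‖(ω : ℂ)‖ ^ (-(2 * σ)) ≤ M := by
    filter_upwards [hev'] with σ hσ
    have hσ1 : 1 < σ := hσ.2
    refine le_trans ?_ hσ.1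
    have h1 : heckeL 0 σ = ((∑' ω : GaussianInt, ‖(ω : ℂ)‖ ^ (-(2 * σ)) : ℝ) : ℂ) := by
      rw [heckeL, Complex.ofReal_tsum]
      exact tsum_congr fun ω => hterm σ ω (by linarith)
    rw [h1, Complex.norm_real]
    refine le_trans ?_ (le_abs_self _)
    exact (summable_norm_gaussianInt_rpow (by linarith : 2 < 2 * σ)).sum_le_tsum F
      (fun ω _ => by positivity)
  have hlim : Tendsto (fun σ : ℝ => ∑ ω ∈ F, ‖(ω : ℂ)‖ ^ (-(2 * σ))) (𝓝[>] 1)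
      (𝓝 (∑ ω ∈ F, ‖(ω : ℂ)‖ ^ (-2 : ℝ))) := by
    refine tendsto_finsetSum _ fun ω _ => ?_
    rcases eq_or_ne ω 0 with rfl | hω
    · refine tendsto_const_nhds.congr' ?_
      filter_upwards [eventually_mem_nhdsWithin] with σ hσ
      have hσ1 : 1 < σ := hσ
      rw [GaussianInt.toComplex_zero, norm_zero, Real.zero_rpow (by norm_num),
        Real.zero_rpow (by linarith)]
    · have hω' : ‖(ω : ℂ)‖ ≠ 0 := by simpa using hω
      have : ContinuousAt (fun σ : ℝ => ‖(ω : ℂ)‖ ^ (-(2 * σ))) 1 :=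
        continuousAt_const.rpow (by fun_prop) (Or.inl hω')
      have h := this.tendsto.mono_left (nhdsWithin_le_nhds (s := Set.Ioi 1))
      simpa using h
  exact le_of_tendsto hlim hle

theorem AnalyticAt.dslope_self {f : ℂ → ℂ} {z : ℂ} (hf : AnalyticAt ℂ f z) :
    AnalyticAt ℂ (dslope f z) z := by
  obtain ⟨p, hp⟩ := hf
  exact ⟨_, hp.has_fpower_series_dslope_fslope⟩

/-- With α = 2 the factor 4 f(2) - 1 = 4^(1-s) - 1 has a simple zero at s = 1, so at most a simple
pole can occur. Unboundedness near 1 shows that it does. -/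
theorem hasHeckeOrder_zero_one : HasHeckeOrder 0 1 (-1) := by
  set c : ℂ → ℂ := fun s => 4 * heckeTerm 0 s ((2 : ℕ) : GaussianInt) - 1 with hc
  set C := heckeDiff ((2 : ℕ) : GaussianInt) (gridRep 2) 0 with hC
  have hca : AnalyticAt ℂ c 1 :=
    (analyticAt_const.mul (analyticAt_heckeTerm _ _ _)).sub analyticAt_const
  have hCa : AnalyticAt ℂ C 1 := analyticAt_heckeDiff (by norm_num) _ _ (by norm_num)
  have h4 : 4 * heckeTerm 0 1 ((2 : ℕ) : GaussianInt) = 1 := by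
    have := natCast_sq_mul_exp (n := 2) (by norm_num) 0
    rw [heckeTerm_natCast _ _ (by norm_num)]
    simpa using this
  have hc1 : c 1 = 0 := by rw [hc]; simp only; rw [h4, sub_self]
  have hCL : ∀ s : ℂ, 1 < s.re → C s = c s * heckeL 0 s := by
    intro s hs
    rw [hC, heckeDiff_eq (bijective_gridRep two_pos) _ hs]
    simp [hc]
  set d := dslope c 1 with hd
  have hda : AnalyticAt ℂ d 1 := hca.dslope_self
  have hcd : ∀ s, c s = (s - 1) * d s := by
    intro s
    have := sub_smul_dslope c 1 s
    rw [hc1, sub_zero, smul_eq_mul] at this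
    exact this.symm
  have hd1 : d 1 ≠ 0 := by
    rw [hd, dslope_same]
    have h5 : HasDerivAt c (4 * (-(logSq ((2 : ℕ) : GaussianInt)) *
        heckeTerm 0 1 ((2 : ℕ) : GaussianInt))) 1 :=
      ((hasDerivAt_heckeTerm 0 _ 1).const_mul 4).sub_const 1
    rw [h5.deriv]
    have h6 : logSq ((2 : ℕ) : GaussianInt) ≠ 0 := by
      have : (((2 : ℕ) : GaussianInt) : ℂ) = 2 := map_natCast _ 2
      rw [logSq, this]
      have : Real.log 2 ≠ 0 := (Real.log_pos one_lt_two).ne'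
      simpa using this
    have h7 : heckeTerm 0 1 ((2 : ℕ) : GaussianInt) ≠ 0 := by
      intro h0
      rw [h0, mul_zero] at h4
      exact zero_ne_one h4
    have h8 : (logSq ((2 : ℕ) : GaussianInt) : ℂ) ≠ 0 := by exact_mod_cast h6
    exact mul_ne_zero (by norm_num) (mul_ne_zero (neg_ne_zero.2 h8) h7)
  have hdne : ∀ᶠ s in 𝓝[{s : ℂ | 1 < s.re}] (1 : ℂ), d s ≠ 0 :=
    (hda.continuousAt.eventually_ne hd1).filter_mono nhdsWithin_le_nhds
  have hs1 : ∀ s : ℂ, 1 < s.re → s - 1 ≠ 0 := by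
    intro s hs h0
    rw [sub_eq_zero.1 h0] at hs
    simp at hs
  -- If the numerator vanished at 1 as well, the factors s - 1 would cancel and L_0 would be bounded
  -- near 1.
  have hC1 : C 1 ≠ 0 := by
    intro hC1
    set D := dslope C 1 with hD
    have hDa : AnalyticAt ℂ (D / d) 1 := hCa.dslope_self.div hda hd1
    have hCD : ∀ s, C s = (s - 1) * D s := by
      intro s
      have := sub_smul_dslope C 1 s
      rw [hC1, sub_zero, smul_eq_mul] at this
      exact this.symm
    refine not_eventually_norm_heckeL_zero_le (‖(D / d) 1‖ + 1) ?_
    have h5 := (hDa.continuousAt.norm.eventually (eventually_le_nhds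
      (lt_add_one ‖(D / d) 1‖))).filter_mono (nhdsWithin_le_nhds (s := {s : ℂ | 1 < s.re}))
    filter_upwards [h5, hdne, eventually_mem_nhdsWithin] with s h6 h7 h8
    have h9 := hCL s h8
    rw [hCD, hcd, mul_assoc] at h9
    have h10 := mul_left_cancel₀ (hs1 s h8) h9
    have h11 : heckeL 0 s = (D / d) s := by
      rw [Pi.div_apply, h10, mul_div_cancel_left₀ _ h7]
    rw [h11]
    exact h6
  refine ⟨C / d, hCa.div hda hd1, ?_, ?_⟩
  · rw [Pi.div_apply]
    exact div_ne_zero hC1 hd1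
  · filter_upwards [hdne, eventually_mem_nhdsWithin] with s h7 h8
    have := hs1 s h8
    rw [Pi.div_apply, hCL s h8, hcd, zpow_neg_one]
    field_simp

/-! ### The Mangoldt function and its divisor sums -/

theorem norm_toComplex_le_of_dvd {d ω : GaussianInt} (hω : ω ≠ 0) (h : d ∣ ω) :
    ‖(d : ℂ)‖ ≤ ‖(ω : ℂ)‖ := by
  obtain ⟨e, rfl⟩ := h
  rw [GaussianInt.toComplex_mul, norm_mul]
  exact le_mul_of_one_le_right (norm_nonneg _) (one_le_norm_gaussianInt (right_ne_zero_of_mul hω))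

theorem gaussianMangoldt_zero : gaussianMangoldt 0 = 0 := by
  refine gaussianMangoldt_eq_zero ?_
  rintro ⟨p, hp, u, hu, n, -, h⟩
  exact mul_ne_zero hu.ne_zero (pow_ne_zero n hp.ne_zero) h.symm

theorem gaussianMangoldt_nonneg (ω : GaussianInt) : 0 ≤ gaussianMangoldt ω := by
  by_cases h : ∃ p, IsUnitMulPrimePow p ω
  · obtain ⟨p, hp⟩ := h
    rw [gaussianMangoldt_eq_log hp]
    exact Real.log_nonneg (one_le_norm_gaussianInt hp.1.ne_zero)
  · rw [gaussianMangoldt_eq_zero h]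

theorem gaussianMangoldt_le_log (ω : GaussianInt) : gaussianMangoldt ω ≤ Real.log ‖(ω : ℂ)‖ := by
  rcases eq_or_ne ω 0 with rfl | hω
  · simp [gaussianMangoldt_zero]
  by_cases h : ∃ p, IsUnitMulPrimePow p ω
  · obtain ⟨p, hp⟩ := h
    rw [gaussianMangoldt_eq_log hp]
    refine Real.log_le_log (by linarith [one_le_norm_gaussianInt hp.1.ne_zero])
      (norm_toComplex_le_of_dvd hω ?_)
    obtain ⟨-, u, -, n, hn, rfl⟩ := hp
    exact (dvd_pow_self p (by omega)).mul_left u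
  · rw [gaussianMangoldt_eq_zero h]
    exact Real.log_nonneg (one_le_norm_gaussianInt hω)

/-- The four units of `ℤ[i]`. -/
def gaussianUnits : Finset GaussianInt := {⟨1, 0⟩, ⟨-1, 0⟩, ⟨0, 1⟩, ⟨0, -1⟩}

theorem isUnit_iff_mem_gaussianUnits {u : GaussianInt} : IsUnit u ↔ u ∈ gaussianUnits := by
  rw [← Zsqrtd.norm_eq_one_iff' (by norm_num) u, Zsqrtd.norm_def]
  obtain ⟨a, b⟩ := u
  simp only [gaussianUnits, Finset.mem_insert, Finset.mem_singleton, Zsqrtd.mk.injEq]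
  constructor
  · intro hω
    have ha : a * a ≤ 1 := by nlinarith [mul_self_nonneg b]
    have hb : b * b ≤ 1 := by nlinarith [mul_self_nonneg a]
    have ha1 : -1 ≤ a := by nlinarith
    have ha2 : a ≤ 1 := by nlinarith
    have hb1 : -1 ≤ b := by nlinarith
    have hb2 : b ≤ 1 := by nlinarith
    interval_cases a <;> interval_cases b <;> omega
  · rintro (⟨rfl, rfl⟩ | ⟨rfl, rfl⟩ | ⟨rfl, rfl⟩ | ⟨rfl, rfl⟩) <;> norm_num

theorem card_gaussianUnits : gaussianUnits.card = 4 := by decide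

open Classical in
/-- The divisors of a nonzero Gaussian integer. -/
noncomputable def gaussianDivisors (ω : GaussianInt) : Finset GaussianInt :=
  (gaussianDisc (‖(ω : ℂ)‖ ^ 2)).filter (· ∣ ω)

theorem mem_gaussianDivisors {d ω : GaussianInt} (hω : ω ≠ 0) : d ∈ gaussianDivisors ω ↔ d ∣ ω := by
  classical
  rw [gaussianDivisors, Finset.mem_filter, mem_gaussianDisc, and_iff_right_iff_imp]
  intro h
  have := norm_toComplex_le_of_dvd hω h
  gcongr

theorem gaussianMangoldt_of_isUnit {u : GaussianInt} (hu : IsUnit u) : gaussianMangoldt u = 0 := by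
  refine gaussianMangoldt_eq_zero ?_
  rintro ⟨p, hp, v, -, n, hn, rfl⟩
  exact hp.not_isUnit (isUnit_of_dvd_unit ((dvd_pow_self p (by omega)).mul_left v) hu)

/-- When p^n is the exact power of p in a = p^n b, the only prime-power divisors of pa that do not
divide a are the four associates of p^(n+1), each of weight log|p|. -/
theorem sum_gaussianMangoldt_new_divisors {p b : GaussianInt} (hp : Prime p) (hb : ¬ p ∣ b) (n : ℕ)
    (ha0 : p ^ n * b ≠ 0) :
    ∑ d ∈ gaussianDivisors (p * (p ^ n * b)) \ gaussianDivisors (p ^ n * b), gaussianMangoldt d =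
      4 * Real.log ‖(p : ℂ)‖ := by
  have hp0 : p ^ (n + 1) ≠ 0 := pow_ne_zero _ hp.ne_zero
  have hpa0 : p * (p ^ n * b) ≠ 0 := mul_ne_zero hp.ne_zero ha0
  have hpa : p * (p ^ n * b) = p ^ (n + 1) * b := by ring
  have hnd : ∀ m, p ^ (m + 1) ∣ p ^ m * b → False := by
    intro m hm
    rw [pow_succ, mul_dvd_mul_iff_left (pow_ne_zero _ hp.ne_zero)] at hm
    exact hb hm
  have hinj : Function.Injective fun u : GaussianInt => u * p ^ (n + 1) := mul_left_injective₀ hp0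
  have hsub : gaussianUnits.image (fun u => u * p ^ (n + 1)) ⊆
      gaussianDivisors (p * (p ^ n * b)) \ gaussianDivisors (p ^ n * b) := by
    intro d hd
    obtain ⟨u, hu, rfl⟩ := Finset.mem_image.1 hd
    have hu' := isUnit_iff_mem_gaussianUnits.2 hu
    rw [Finset.mem_sdiff, mem_gaussianDivisors hpa0, mem_gaussianDivisors ha0,
      hu'.mul_left_dvd, hu'.mul_left_dvd, hpa]
    exact ⟨dvd_mul_right _ _, fun h => hnd n h⟩
  rw [← Finset.sum_subset hsub, Finset.sum_image hinj.injOn]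
  · have h1 : ∀ u ∈ gaussianUnits, gaussianMangoldt (u * p ^ (n + 1)) = Real.log ‖(p : ℂ)‖ :=
      fun u hu => gaussianMangoldt_eq_log
        ⟨hp, u, isUnit_iff_mem_gaussianUnits.2 hu, n + 1, by omega, rfl⟩
    rw [Finset.sum_congr rfl h1, Finset.sum_const, card_gaussianUnits, nsmul_eq_mul]
    norm_num
  · intro d hd hdn
    rw [Finset.mem_sdiff, mem_gaussianDivisors hpa0, mem_gaussianDivisors ha0] at hd
    refine gaussianMangoldt_eq_zero ?_
    rintro ⟨q, hq, u, hu, m, hm, rfl⟩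
    rw [hu.mul_left_dvd, hu.mul_left_dvd] at hd
    -- If q were not associated to p, multiplying by p could not create the divisor q^m, so q^m
    -- would already divide p^n b.
    have hqp : q ∣ p := by
      by_contra hqp
      exact hd.2 (hq.pow_dvd_of_dvd_mul_left m hqp hd.1)
    obtain ⟨w, rfl⟩ := (hq.dvd_prime_iff_associated hp).1 hqp
    have hassoc : ∀ j, (q * (w : GaussianInt)) ^ j = q ^ j * ((w ^ j : GaussianIntˣ) : GaussianInt) := by
      intro j
      rw [mul_pow, Units.val_pow_eq_pow_val]
    have hd1 : (q * (w : GaussianInt)) ^ m ∣ (q * w) ^ (n + 1) * b := by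
      rw [hassoc, Units.mul_right_dvd, ← hpa]
      exact hd.1
    have hd2 : ¬ (q * (w : GaussianInt)) ^ m ∣ (q * w) ^ n * b := by
      rw [hassoc, Units.mul_right_dvd]
      exact hd.2
    have h1 : n + 1 ≤ m := by
      by_contra! h
      exact hd2 ((pow_dvd_pow _ (by omega)).mul_right _)
    have h2 : m ≤ n + 1 := by
      by_contra! h
      exact hnd (n + 1) ((pow_dvd_pow _ (by omega)).trans hd1)
    have h3 : m = n + 1 := le_antisymm h2 h1
    subst h3
    refine hdn (Finset.mem_image.2 ⟨u * ((w ^ (n + 1))⁻¹ : GaussianIntˣ), ?_, ?_⟩)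
    · exact isUnit_iff_mem_gaussianUnits.1 (hu.mul (Units.isUnit _))
    · rw [hassoc, mul_assoc, mul_comm (q ^ (n + 1)), Units.inv_mul_cancel_left]

/-- The analogue of `∑_{d ∣ n} Λ(d) = log n`; every divisor is counted with its associates. -/
theorem sum_divisors_gaussianMangoldt {ω : GaussianInt} (hω : ω ≠ 0) :
    ∑ d ∈ gaussianDivisors ω, gaussianMangoldt d = 4 * Real.log ‖(ω : ℂ)‖ := by
  induction ω using UniqueFactorizationMonoid.induction_on_prime with
  | h₁ => exact absurd rfl hω
  | h₂ u hu =>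
    have h1 : ‖(u : ℂ)‖ = 1 :=
      norm_toComplex_eq_one_iff.2 ((Zsqrtd.norm_eq_one_iff' (by norm_num) u).2 hu)
    rw [h1, Real.log_one, mul_zero]
    refine Finset.sum_eq_zero fun d hd => gaussianMangoldt_of_isUnit ?_
    exact isUnit_of_dvd_unit ((mem_gaussianDivisors hω).1 hd) hu
  | h₃ a p ha hp ih =>
    obtain ⟨n, b, hb, hab⟩ := WfDvdMonoid.max_power_factor ha hp.irreducible
    have hsub : gaussianDivisors a ⊆ gaussianDivisors (p * a) := by
      intro d hd
      rw [mem_gaussianDivisors hω]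
      exact ((mem_gaussianDivisors ha).1 hd).mul_left p
    rw [← Finset.sum_sdiff hsub, ih ha, GaussianInt.toComplex_mul, norm_mul,
      Real.log_mul (by simpa using hp.ne_zero) (by simpa using ha), mul_add]
    congr 1
    rw [hab] at ha ⊢
    exact sum_gaussianMangoldt_new_divisors hp hb n ha

/-! ### The twisted Mangoldt series as a logarithmic derivative -/

/-- The Dirichlet series of `Λ` twisted by the Hecke character of frequency `k`. -/
noncomputable def heckeMangoldt (k : ℤ) (s : ℂ) : ℂ :=
  ∑' ω : GaussianInt, (gaussianMangoldt ω : ℂ) * heckeTerm k s ω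

/-- The bound log y ≤ y^(σ-1)/(σ - 1) spends half of the excess of 2σ over 2 on the logarithm; the
remaining exponent σ + 1 still exceeds 2. -/
theorem gaussianMangoldt_mul_rpow_le {σ : ℝ} (hσ : 1 < σ) (ω : GaussianInt) :
    gaussianMangoldt ω * ‖(ω : ℂ)‖ ^ (-(2 * σ)) ≤ ‖(ω : ℂ)‖ ^ (-(σ + 1)) * (σ - 1)⁻¹ := by
  have hσ' : 0 < σ - 1 := by linarith
  rcases eq_or_ne ω 0 with rfl | hω
  · rw [gaussianMangoldt_zero, zero_mul]
    positivity
  have h0 : 0 < ‖(ω : ℂ)‖ := by linarith [one_le_norm_gaussianInt hω]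
  have h1 := (gaussianMangoldt_le_log ω).trans (Real.log_le_rpow_div h0.le hσ')
  calc _ ≤ ‖(ω : ℂ)‖ ^ (σ - 1) / (σ - 1) * ‖(ω : ℂ)‖ ^ (-(2 * σ)) := by gcongr
    _ = _ := by
      rw [show -(σ + 1) = (σ - 1) + -(2 * σ) by ring, Real.rpow_add h0]
      ring

theorem summable_norm_heckeMangoldt (k : ℤ) {s : ℂ} (hs : 1 < s.re) :
    Summable fun ω : GaussianInt => ‖(gaussianMangoldt ω : ℂ) * heckeTerm k s ω‖ := by
  refine Summable.of_nonneg_of_le (fun _ => norm_nonneg _) (fun ω => ?_)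
    ((summable_norm_gaussianInt_rpow (by linarith : 2 < s.re + 1)).mul_right (s.re - 1)⁻¹)
  refine le_trans ?_ (gaussianMangoldt_mul_rpow_le hs ω)
  rw [norm_mul, Complex.norm_real, Real.norm_of_nonneg (gaussianMangoldt_nonneg ω)]
  exact mul_le_mul_of_nonneg_left (norm_heckeTerm_le k le_rfl ω) (gaussianMangoldt_nonneg ω)

/-- A factorization ω = de is determined by d, so the fibre of multiplication over ω ≠ 0 is the set
of its divisors. -/
theorem tsum_fiber_gaussianMangoldt {ω : GaussianInt} (hω : ω ≠ 0) :
    ∑' p : (fun p : GaussianInt × GaussianInt => p.1 * p.2) ⁻¹' {ω}, gaussianMangoldt p.1.1 =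
      4 * Real.log ‖(ω : ℂ)‖ := by
  set F := (fun p : GaussianInt × GaussianInt => p.1 * p.2) ⁻¹' {ω} with hF
  have hmul : ∀ p : F, p.1.1 * p.1.2 = ω := fun p => p.2
  have hbij : Function.Bijective fun p : F =>
      (⟨p.1.1, (mem_gaussianDivisors hω).2 ⟨p.1.2, (hmul p).symm⟩⟩ : gaussianDivisors ω) := by
    constructor
    · intro p q h
      have h1 : p.1.1 = q.1.1 := congrArg Subtype.val h
      have h2 : p.1.1 * p.1.2 = p.1.1 * q.1.2 := by rw [hmul, h1, hmul]
      have h3 : p.1.1 ≠ 0 := by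
        intro h0
        have := hmul p
        rw [h0, zero_mul] at this
        exact hω this.symm
      exact Subtype.ext (Prod.ext h1 (mul_left_cancel₀ h3 h2))
    · rintro ⟨d, hd⟩
      obtain ⟨e, he⟩ := (mem_gaussianDivisors hω).1 hd
      exact ⟨⟨(d, e), he.symm⟩, rfl⟩
  have h1 := (Equiv.ofBijective _ hbij).tsum_eq fun d : gaussianDivisors ω => gaussianMangoldt d
  simp only [Equiv.ofBijective_apply] at h1
  rw [h1, Finset.tsum_subtype, sum_divisors_gaussianMangoldt hω]

/-- Grouping the double series by the product ω gives the coefficient 4 log|ω| = 2 log|ω|², whereas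
differentiating L_k brings down -log|ω|². -/
theorem heckeMangoldt_mul_heckeL (k : ℤ) {s : ℂ} (hs : 1 < s.re) :
    heckeMangoldt k s * heckeL k s = -2 * deriv (heckeL k) s := by
  have h1 := summable_norm_heckeMangoldt k hs
  have h2 := summable_norm_heckeTerm k hs
  have hprod := summable_mul_of_summable_norm h1 h2
  have hfib := hprod.hasSum.tsum_fiberwise fun p : GaussianInt × GaussianInt => p.1 * p.2
  rw [heckeMangoldt, heckeL, tsum_mul_tsum_of_summable_norm h1 h2, ← hfib.tsum_eq,
    ← (hasSum_deriv_heckeL k hs).tsum_eq, ← tsum_mul_left]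
  refine tsum_congr fun ω => ?_
  have h3 : ∀ p : (fun p : GaussianInt × GaussianInt => p.1 * p.2) ⁻¹' {ω},
      (gaussianMangoldt p.1.1 : ℂ) * heckeTerm k s p.1.1 * heckeTerm k s p.1.2 =
        (gaussianMangoldt p.1.1 : ℂ) * heckeTerm k s ω := by
    intro p
    have h4 : p.1.1 * p.1.2 = ω := p.2
    rw [mul_assoc, ← heckeTerm_mul, ← GaussianInt.toComplex_mul, h4]
  simp_rw [h3]
  rw [tsum_mul_right, ← Complex.ofReal_tsum]
  rcases eq_or_ne ω 0 with rfl | hω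
  · simp
  · rw [tsum_fiber_gaussianMangoldt hω, logSq]
    push_cast
    ring

theorem differentiableOn_heckeMangoldt (k : ℤ) :
    DifferentiableOn ℂ (heckeMangoldt k) {s | 1 < s.re} := by
  intro s hs
  obtain ⟨σ, hσ1, hσ⟩ := exists_between (show 1 < s.re from hs)
  have h := Complex.differentiableOn_tsum_of_summable_norm
    (F := fun (ω : GaussianInt) s => (gaussianMangoldt ω : ℂ) * heckeTerm k s ω)
    (U := {s : ℂ | σ < s.re})
    ((summable_norm_gaussianInt_rpow (by linarith : 2 < σ + 1)).mul_right (σ - 1)⁻¹)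
    (fun ω => ((differentiable_heckeTerm k ω).const_mul _).differentiableOn) (isOpen_lt_re σ)
    (fun ω w hw => by
      refine le_trans ?_ (gaussianMangoldt_mul_rpow_le hσ1 ω)
      rw [norm_mul, Complex.norm_real, Real.norm_of_nonneg (gaussianMangoldt_nonneg ω)]
      exact mul_le_mul_of_nonneg_left (norm_heckeTerm_le k (le_of_lt hw) ω)
        (gaussianMangoldt_nonneg ω))
  exact (h.differentiableAt ((isOpen_lt_re σ).mem_nhds hσ)).differentiableWithinAt

/-- The logarithmic derivative of (s - s₀)^n g(s) is n/(s - s₀) + g'/g, and g'/g is continuous at s₀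
because g(s₀) ≠ 0. -/
theorem HasHeckeOrder.heckeMangoldt_eq {k : ℤ} {s₀ : ℂ} (hs₀ : s₀.re = 1) {n : ℤ}
    (h : HasHeckeOrder k s₀ n) : ∃ φ : ℂ → ℂ, ContinuousAt φ s₀ ∧
      ∀ᶠ s in 𝓝[{s | 1 < s.re}] s₀, heckeMangoldt k s = -2 * n / (s - s₀) + φ s := by
  obtain ⟨g, hg, hg0, hL⟩ := h
  refine ⟨fun s => -2 * (deriv g s / g s), ?_, ?_⟩
  · exact (hg.deriv.continuousAt.div hg.continuousAt hg0).const_mul _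
  filter_upwards [eventually_eventually_nhdsWithin.2 hL, eventually_mem_nhdsWithin,
    hg.eventually_analyticAt.filter_mono nhdsWithin_le_nhds,
    (hg.continuousAt.eventually_ne hg0).filter_mono nhdsWithin_le_nhds] with s h1 h2 h3 h4
  have hs : 1 < s.re := h2
  have hne : s - s₀ ≠ 0 := by
    intro h0
    rw [sub_eq_zero.1 h0, hs₀] at hs
    exact lt_irrefl _ hs
  rw [(isOpen_lt_re 1).nhdsWithin_eq h2] at h1
  replace h1 : heckeL k =ᶠ[𝓝 s] fun s => (s - s₀) ^ n * g s := h1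
  have h5 : HasDerivAt (fun s => (s - s₀) ^ n * g s)
      (n * (s - s₀) ^ (n - 1) * g s + (s - s₀) ^ n * deriv g s) s := by
    have h6 := (hasDerivAt_zpow n (s - s₀) (Or.inl hne)).comp s ((hasDerivAt_id s).sub_const s₀)
    rw [mul_one] at h6
    exact h6.mul h3.differentiableAt.hasDerivAt
  have h7 := heckeMangoldt_mul_heckeL k hs
  rw [h1.deriv_eq, h5.deriv, h1.eq_of_nhds, zpow_sub_one₀ hne] at h7
  have h8 : (s - s₀) ^ n ≠ 0 := zpow_ne_zero n hne
  have h9 : heckeMangoldt k s * g s = -2 * (n * (s - s₀)⁻¹ * g s + deriv g s) := by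
    apply mul_left_cancel₀ h8
    linear_combination h7
  field_simp
  field_simp at h9
  linear_combination h9

/-! ### Nonvanishing on the line Re s = 1 -/

theorem tendsto_add_ofReal_nhdsWithin {s₀ : ℂ} (hs₀ : s₀.re = 1) :
    Tendsto (fun ε : ℝ => s₀ + ε) (𝓝[>] 0) (𝓝[{s | 1 < s.re}] s₀) := by
  refine tendsto_nhdsWithin_iff.2 ⟨?_, eventually_mem_nhdsWithin.mono fun ε hε => ?_⟩
  · exact (Continuous.tendsto' (by fun_prop) 0 s₀ (by simp)).mono_left nhdsWithin_le_nhds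
  · simpa [hs₀] using hε

/-- Approaching s₀ horizontally reads off the residue -2n; the real part suffices for the positivity
argument. -/
theorem HasHeckeOrder.tendsto_mul_heckeMangoldt {k : ℤ} {s₀ : ℂ} (hs₀ : s₀.re = 1) {n : ℤ}
    (h : HasHeckeOrder k s₀ n) :
    Tendsto (fun ε : ℝ => ε * (heckeMangoldt k (s₀ + ε)).re) (𝓝[>] 0) (𝓝 (-2 * n)) := by
  obtain ⟨φ, hφ, hev⟩ := h.heckeMangoldt_eq hs₀
  have ht := tendsto_add_ofReal_nhdsWithin hs₀
  have h1 : Tendsto (fun ε : ℝ => (ε : ℂ) * φ (s₀ + ε)) (𝓝[>] 0) (𝓝 (0 * φ s₀)) :=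
    ((Complex.continuous_ofReal.tendsto' 0 0 (by simp)).mono_left nhdsWithin_le_nhds).mul
      (hφ.tendsto.comp (ht.mono_right nhdsWithin_le_nhds))
  have h2 := (Complex.continuous_re.tendsto _).comp (h1.const_add (-2 * (n : ℂ)))
  have h3 : (-2 * (n : ℂ) + 0 * φ s₀).re = -2 * n := by simp
  rw [h3] at h2
  refine h2.congr' ?_
  filter_upwards [ht.eventually hev, eventually_mem_nhdsWithin] with ε h4 h5
  have hε : (ε : ℂ) ≠ 0 := by exact_mod_cast (ne_of_gt (show 0 < ε from h5))
  simp only [Function.comp]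
  rw [h4, ← Complex.re_ofReal_mul, add_sub_cancel_left]
  congr 1
  field_simp

theorem heckeTerm_eq_mul_exp (k : ℤ) (s z : ℂ) :
    heckeTerm k s z = heckeTerm k 0 z * Complex.exp (-s * logSq z) := by
  rcases eq_or_ne z 0 with rfl | hz
  · simp
  · rw [heckeTerm_of_ne_zero _ _ hz, heckeTerm_of_ne_zero _ _ hz]
    simp

/-- The inequality `3 + 4 cos θ + cos 2θ ≥ 0`, summed against `Λ`. -/
theorem heckeMangoldt_three_four_one (k : ℤ) (t : ℝ) {ε : ℝ} (hε : 0 < ε) :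
    0 ≤ 3 * (heckeMangoldt 0 (1 + ε)).re + 4 * (heckeMangoldt k (1 + t * Complex.I + ε)).re +
      (heckeMangoldt (2 * k) (1 + (2 * t : ℝ) * Complex.I + ε)).re := by
  have hre : ∀ (k : ℤ) (s : ℂ), 1 < s.re → HasSum (fun ω : GaussianInt =>
      gaussianMangoldt ω * (heckeTerm k s ω).re) (heckeMangoldt k s).re := by
    intro k s hs
    have := Complex.hasSum_re (summable_norm_heckeMangoldt k hs).of_norm.hasSum
    simp only [Complex.re_ofReal_mul] at this
    exact this
  have h0 := hre 0 (1 + ε) (by simpa using hε)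
  have h1 := hre k (1 + t * Complex.I + ε) (by simpa using hε)
  have h2 := hre (2 * k) (1 + (2 * t : ℝ) * Complex.I + ε) (by simpa using hε)
  refine HasSum.nonneg (fun ω => ?_) (((h0.mul_left 3).add (h1.mul_left 4)).add h2)
  rcases eq_or_ne ω 0 with rfl | hω
  · simp
  have hω' : (ω : ℂ) ≠ 0 := by simpa using hω
  -- The three terms at ω are r, rz and rz² with |z| = 1, so the combination of real parts is r(3 +
  -- 4x + 2x² - 1) = 2r(1 + x)² with x = Re z.
  set z : ℂ := heckeTerm k (t * Complex.I) ω with hz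
  set r : ℝ := Real.exp (-(1 + ε) * logSq ω) with hr
  have hzn : ‖z‖ = 1 := by rw [hz, norm_heckeTerm _ _ hω']; simp
  have hrC : (r : ℂ) = Complex.exp (-(1 + ε) * logSq ω) := by rw [hr]; push_cast; rfl
  have e0 : heckeTerm 0 (1 + ε) ω = r := by
    rw [heckeTerm_of_ne_zero _ _ hω', hrC]; simp
  have e1 : heckeTerm k (1 + t * Complex.I + ε) ω = r * z := by
    rw [hz, heckeTerm_of_ne_zero _ _ hω', heckeTerm_of_ne_zero _ _ hω', hrC,
      show -(1 + t * Complex.I + ε) * (logSq ω : ℂ) =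
        -(1 + ε) * logSq ω + -(t * Complex.I) * logSq ω by ring, Complex.exp_add]
    ring
  have e2 : heckeTerm (2 * k) (1 + (2 * t : ℝ) * Complex.I + ε) ω = r * z ^ 2 := by
    rw [hz, heckeTerm_of_ne_zero _ _ hω', heckeTerm_of_ne_zero _ _ hω', hrC, mul_pow,
      ← Complex.exp_nat_mul, mul_comm 2 k, zpow_mul]
    rw [show -(1 + ((2 * t : ℝ) : ℂ) * Complex.I + ε) * (logSq ω : ℂ) =
        -(1 + ε) * logSq ω + (2 : ℕ) * (-(t * Complex.I) * logSq ω) by push_cast; ring,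
      Complex.exp_add]
    rw [zpow_ofNat]
    ring
  rw [e0, e1, e2, Complex.re_ofReal_mul, Complex.re_ofReal_mul, Complex.ofReal_re]
  have h3 : z.re ^ 2 + z.im ^ 2 = 1 := by
    rw [← one_pow 2, ← hzn, ← Complex.normSq_eq_norm_sq, Complex.normSq_apply]
    ring
  have h4 : (z ^ 2).re = 2 * z.re ^ 2 - 1 := by
    rw [pow_two, Complex.mul_re]
    linarith
  rw [h4]
  have h5 : 0 ≤ gaussianMangoldt ω * r * (2 * (1 + z.re) ^ 2) :=
    mul_nonneg (mul_nonneg (gaussianMangoldt_nonneg ω) (Real.exp_nonneg _)) (by positivity)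
  linarith

/-- `heckeL (4 h)` does not vanish at `1 + i t`. -/
theorem hasHeckeOrder_eq_zero {h : ℤ} {t : ℝ} (hht : h ≠ 0 ∨ t ≠ 0) :
    HasHeckeOrder (4 * h) (1 + t * Complex.I) 0 := by
  obtain ⟨n, hn⟩ := exists_hasHeckeOrder hht
  obtain ⟨m, hm⟩ := exists_hasHeckeOrder (h := 2 * h) (t := 2 * t) (by simpa using hht)
  have h0 := hasHeckeOrder_zero_one.tendsto_mul_heckeMangoldt (by simp)
  have h1 := hn.tendsto_mul_heckeMangoldt (by simp)
  have h2 := hm.tendsto_mul_heckeMangoldt (by simp)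
  have h3 := ((h0.const_mul 3).add (h1.const_mul 4)).add h2
  -- The limit reads 6 - 8n - 2m ≥ 0, where m is the order for frequency and height both doubled. As
  -- m and n are natural numbers, n = 0.
  have h4 : 0 ≤ 3 * (-2 * ((-1 : ℤ) : ℝ)) + 4 * (-2 * ((n : ℤ) : ℝ)) + -2 * ((m : ℤ) : ℝ) := by
    refine ge_of_tendsto h3 ?_
    filter_upwards [eventually_mem_nhdsWithin] with ε hε
    have h5 := heckeMangoldt_three_four_one (4 * h) t (show 0 < ε from hε)
    rw [show 2 * (4 * h) = 4 * (2 * h) by ring] at h5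
    have h6 := mul_nonneg (le_of_lt (show 0 < ε from hε)) h5
    linarith
  have h7 : (n : ℤ) = 0 := by
    have h8 : (0 : ℤ) ≤ 3 * (-2 * (-1)) + 4 * (-2 * n) + -2 * m := by exact_mod_cast h4
    omega
  rwa [h7] at hn

/-! ### Boundary behaviour and the asymptotics -/

theorem exists_tendsto_heckeMangoldt_sub (h : ℤ) {s₀ : ℂ} (hs₀ : 1 ≤ s₀.re) :
    ∃ c, Tendsto (fun s => heckeMangoldt (4 * h) s - (if h = 0 then 2 else 0 : ℝ) / (s - 1))
      (𝓝[{s | 1 < s.re}] s₀) (𝓝 c) := by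
  have hpole : ∀ A : ℝ, s₀ ≠ 1 →
      Tendsto (fun s : ℂ => (A : ℂ) / (s - 1)) (𝓝[{s | 1 < s.re}] s₀) (𝓝 (A / (s₀ - 1))) := by
    intro A hne
    refine Tendsto.mono_left ?_ nhdsWithin_le_nhds
    exact tendsto_const_nhds.div (Continuous.tendsto (by fun_prop) _) (sub_ne_zero.2 hne)
  rcases hs₀.lt_or_eq with hlt | heq
  · have hne : s₀ ≠ 1 := by
      rintro rfl
      simp at hlt
    exact ⟨_, (((differentiableOn_heckeMangoldt (4 * h)).continuousOn s₀ hlt).tendsto).sub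
      (hpole _ hne)⟩
  by_cases hht : h ≠ 0 ∨ s₀.im ≠ 0
  · have hs : s₀ = 1 + s₀.im * Complex.I := by
      apply Complex.ext <;> simp [← heq]
    have hord := hasHeckeOrder_eq_zero hht
    rw [← hs] at hord
    obtain ⟨φ, hφ, hev⟩ := hord.heckeMangoldt_eq heq.symm
    have h1 : Tendsto (heckeMangoldt (4 * h)) (𝓝[{s | 1 < s.re}] s₀) (𝓝 (φ s₀)) := by
      refine (hφ.tendsto.mono_left nhdsWithin_le_nhds).congr' ?_
      filter_upwards [hev] with s h2
      rw [h2]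
      simp
    by_cases hh : h = 0
    · have hne : s₀ ≠ 1 := by
        rintro rfl
        rcases hht with h3 | h3
        · exact h3 hh
        · simp at h3
      exact ⟨_, h1.sub (hpole _ hne)⟩
    · refine ⟨φ s₀, ?_⟩
      simpa [hh] using h1
  · push Not at hht
    obtain ⟨rfl, him⟩ := hht
    have hs : s₀ = 1 := by
      apply Complex.ext <;> simp [← heq, him]
    subst hs
    obtain ⟨φ, hφ, hev⟩ := hasHeckeOrder_zero_one.heckeMangoldt_eq heq.symm
    refine ⟨φ 1, (hφ.tendsto.mono_left nhdsWithin_le_nhds).congr' ?_⟩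
    filter_upwards [hev] with s h2
    rw [mul_zero, h2]
    simp

/-- The Tauberian theorem applied to `Λ(ω) (1 + Re (c (ω / |ω|) ^ (4 h)))`. -/
theorem tendsto_sum_mangoldt_twist {h : ℤ} (hh : h ≠ 0) {c : ℂ} (hc : ‖c‖ ≤ 1) :
    Tendsto (fun x : ℝ => x⁻¹ * ∑ ω ∈ gaussianDisc x,
      gaussianMangoldt ω * (1 + (c * heckeTerm (4 * h) 0 ω).re)) atTop (𝓝 2) := by
  set a : GaussianInt → ℝ := fun ω =>
    gaussianMangoldt ω * (1 + (c * heckeTerm (4 * h) 0 ω).re) with ha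
  have hle : ∀ ω : GaussianInt, |(c * heckeTerm (4 * h) 0 ω).re| ≤ 1 := by
    intro ω
    refine (Complex.abs_re_le_norm _).trans ?_
    rw [norm_mul]
    exact mul_le_one₀ hc (norm_nonneg _) (norm_heckeTerm_le_one _ (by simp) ω)
  have ha0 : ∀ ω, 0 ≤ a ω := fun ω =>
    mul_nonneg (gaussianMangoldt_nonneg ω) (by linarith [(abs_le.1 (hle ω)).1])
  have hzero : ∀ (s : ℂ) (ω : GaussianInt),
      (gaussianMangoldt ω : ℂ) * heckeTerm (4 * 0) s ω =
        gaussianMangoldt ω * Complex.exp (-s * logSq ω) := by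
    intro s ω
    rcases eq_or_ne ω 0 with rfl | hω
    · simp [gaussianMangoldt_zero]
    · rw [heckeTerm_of_ne_zero _ _ (by simpa using hω)]
      simp
  have hsum : ∀ σ : ℝ, 1 < σ → Summable fun ω : GaussianInt => a ω * Real.exp (-σ * logSq ω) := by
    intro σ hσ
    have h1 := (summable_norm_heckeMangoldt (4 * 0) (s := σ) (by simpa using hσ)).mul_left 2
    refine Summable.of_nonneg_of_le (fun ω => mul_nonneg (ha0 ω) (Real.exp_nonneg _))
      (fun ω => ?_) h1
    rw [hzero, norm_mul, Complex.norm_real, Real.norm_of_nonneg (gaussianMangoldt_nonneg ω),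
      Complex.norm_exp]
    have h2 : (-(σ : ℂ) * logSq ω).re = -σ * logSq ω := by simp
    have h3 : a ω ≤ 2 * gaussianMangoldt ω := by
      have := mul_le_mul_of_nonneg_left (abs_le.1 (hle ω)).2 (gaussianMangoldt_nonneg ω)
      simp only [ha]
      linarith
    rw [h2, ← mul_assoc]
    gcongr
  -- Conjugation replaces h by -h, so the real part is half the sum of the twists by h and -h. As h
  -- ≠ 0, neither contributes a pole at 1.
  have hconj : ∀ ω : GaussianInt,
      heckeTerm (4 * -h) 0 ω = (starRingEnd ℂ) (heckeTerm (4 * h) 0 ω) := by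
    intro ω
    rcases eq_or_ne ω 0 with rfl | hω
    · simp
    · have hω' : (ω : ℂ) ≠ 0 := by simpa using hω
      rw [← Complex.inv_eq_conj (by rw [norm_heckeTerm _ _ hω']; simp), heckeTerm_of_ne_zero _ _ hω',
        heckeTerm_of_ne_zero _ _ hω']
      simp
  have hG : ∀ s : ℂ, 1 < s.re → ∑' ω : GaussianInt, (a ω : ℂ) * Complex.exp (-s * logSq ω) =
      heckeMangoldt (4 * 0) s + c / 2 * heckeMangoldt (4 * h) s +
        (starRingEnd ℂ) c / 2 * heckeMangoldt (4 * -h) s := by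
    intro s hs
    have h0 := (summable_norm_heckeMangoldt (4 * 0) hs).of_norm.hasSum
    have h1 := (summable_norm_heckeMangoldt (4 * h) hs).of_norm.hasSum
    have h2 := (summable_norm_heckeMangoldt (4 * -h) hs).of_norm.hasSum
    refine HasSum.tsum_eq ?_
    refine ((h0.add (h1.mul_left (c / 2))).add (h2.mul_left ((starRingEnd ℂ) c / 2))).congr_fun ?_
    intro ω
    rw [hzero, heckeTerm_eq_mul_exp (4 * h), heckeTerm_eq_mul_exp (4 * -h), hconj]
    simp only [ha]
    push_cast
    rw [Complex.re_eq_add_conj, map_mul]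
    ring
  have hlim : ∀ s₀ : ℂ, 1 ≤ s₀.re → ∃ l, Tendsto (fun s => (heckeMangoldt (4 * 0) s +
      c / 2 * heckeMangoldt (4 * h) s + (starRingEnd ℂ) c / 2 * heckeMangoldt (4 * -h) s) -
        (2 : ℝ) / (s - 1)) (𝓝[{s | 1 < s.re}] s₀) (𝓝 l) := by
    intro s₀ hs₀
    obtain ⟨l0, h0⟩ := exists_tendsto_heckeMangoldt_sub 0 hs₀
    obtain ⟨l1, h1⟩ := exists_tendsto_heckeMangoldt_sub h hs₀
    obtain ⟨l2, h2⟩ := exists_tendsto_heckeMangoldt_sub (-h) hs₀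
    refine ⟨_, ((h0.add (h1.const_mul (c / 2))).add
      (h2.const_mul ((starRingEnd ℂ) c / 2))).congr fun s => ?_⟩
    simp only [hh, if_true, if_false, neg_eq_zero]
    push_cast
    ring
  have : Countable GaussianInt :=
    Function.Injective.countable (f := fun ω : GaussianInt => (ω.re, ω.im)) fun x y hxy =>
      Zsqrtd.ext (congrArg Prod.fst hxy) (congrArg Prod.snd hxy)
  -- With v = log x and exponents log|ω|², the condition on ω becomes |ω|² ≤ x. The point ω = 0,
  -- where `logSq` takes the default value 0, is harmless because Λ(0) = 0.
  have hmain := (tendsto_tsum_div_exp ha0 logSq_nonneg hsum hG hlim).comp Real.tendsto_log_atTop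
  refine hmain.congr' ?_
  filter_upwards [eventually_gt_atTop 0] with x hx
  simp only [Function.comp]
  rw [Real.exp_neg, Real.exp_log hx]
  congr 1
  rw [tsum_eq_sum (s := gaussianDisc x)]
  · refine Finset.sum_congr rfl fun ω hω => ?_
    rcases eq_or_ne ω 0 with rfl | h0
    · simp [ha, gaussianMangoldt_zero]
    · rw [if_pos]
      have h1 : (ω : ℂ) ≠ 0 := by simpa using h0
      have h2 := Real.log_le_log (by positivity) (mem_gaussianDisc.1 hω)
      rw [Real.log_pow] at h2
      exact_mod_cast h2
  · intro ω hω
    rcases eq_or_ne ω 0 with rfl | h0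
    · simp [ha, gaussianMangoldt_zero]
    · rw [if_neg]
      intro h3
      have h1 : (ω : ℂ) ≠ 0 := by simpa using h0
      refine hω (mem_gaussianDisc.2 ((Real.log_le_log_iff (by positivity) hx).1 ?_))
      rw [Real.log_pow]
      exact_mod_cast h3

theorem mangoldt_mul_exp_arg (h : ℤ) (ω : GaussianInt) :
    Complex.exp (4 * Complex.I * (h : ℂ) * ((ω : ℂ).arg : ℂ)) * (gaussianMangoldt ω : ℂ) =
      heckeTerm (4 * h) 0 ω * gaussianMangoldt ω := by
  rcases eq_or_ne ω 0 with rfl | hω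
  · simp [gaussianMangoldt_zero]
  have h0 : (ω : ℂ) ≠ 0 := by simpa using hω
  have hn : (‖(ω : ℂ)‖ : ℂ) ≠ 0 := by simpa using h0
  have h1 : (ω : ℂ) / ‖(ω : ℂ)‖ = Complex.exp ((ω : ℂ).arg * Complex.I) := by
    rw [div_eq_iff hn, mul_comm, Complex.norm_mul_exp_arg_mul_I]
  rw [heckeTerm_of_ne_zero _ _ h0, h1, ← Complex.exp_int_mul]
  push_cast
  simp only [neg_zero, zero_mul, Complex.exp_zero, mul_one]
  ring_nf

theorem proposition5p24 :
    gaussianPsi ~[atTop] (fun x : ℝ => 2 * x) ∧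
    ∀ h : ℤ, h ≠ 0 →
      (fun x : ℝ => ∑ ω ∈ gaussianDisc x,
        Complex.exp (4 * Complex.I * (h : ℂ) * ((ω : ℂ).arg : ℂ)) * (gaussianMangoldt ω : ℂ))
        =o[atTop] (fun x : ℝ => x) := by
  have hpsi : Tendsto (fun x : ℝ => x⁻¹ * gaussianPsi x) atTop (𝓝 2) := by
    simpa [gaussianPsi] using tendsto_sum_mangoldt_twist one_ne_zero (c := 0) (by simp)
  constructor
  · refine isEquivalent_of_tendsto_one ?_
    have h1 := hpsi.div_const 2
    rw [div_self two_ne_zero] at h1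
    refine h1.congr fun x => ?_
    rw [Pi.div_apply]
    ring
  · intro h hh
    have htwist : ∀ c : ℂ, ‖c‖ ≤ 1 → Tendsto (fun x : ℝ => x⁻¹ * ∑ ω ∈ gaussianDisc x,
        gaussianMangoldt ω * (c * heckeTerm (4 * h) 0 ω).re) atTop (𝓝 0) := by
      intro c hc
      have h1 := (tendsto_sum_mangoldt_twist hh hc).sub hpsi
      rw [sub_self] at h1
      refine h1.congr fun x => ?_
      rw [gaussianPsi, ← mul_sub, ← Finset.sum_sub_distrib]
      simp only [mul_add, mul_one, add_sub_cancel_left]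
    -- The choice c = 1 isolates the real part of the character and c = -i its imaginary part, since
    -- Re(-iw) = Im w.
    have hre := htwist 1 (by simp)
    have him := htwist (-Complex.I) (by simp)
    have hlim := ((Complex.continuous_ofReal.tendsto _).comp hre).add
      (((Complex.continuous_ofReal.tendsto _).comp him).mul_const Complex.I)
    have h2 : (fun x : ℝ => ∑ ω ∈ gaussianDisc x,
        Complex.exp (4 * Complex.I * (h : ℂ) * ((ω : ℂ).arg : ℂ)) * (gaussianMangoldt ω : ℂ))
        =o[atTop] (fun x : ℝ => (x : ℂ)) := by
      refine (isLittleO_iff_tendsto' ?_).2 ?_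
      · filter_upwards [eventually_gt_atTop 0] with x hx h0
        exact absurd h0 (by exact_mod_cast hx.ne')
      · rw [Complex.ofReal_zero, zero_mul, add_zero] at hlim
        refine hlim.congr fun x => ?_
        simp only [Function.comp]
        push_cast
        rw [mul_assoc, ← mul_add, div_eq_inv_mul, Finset.sum_mul, ← Finset.sum_add_distrib]
        congr 1
        refine Finset.sum_congr rfl fun ω _ => ?_
        rw [mangoldt_mul_exp_arg]
        have h3 : (-Complex.I * heckeTerm (4 * h) 0 ω).re = (heckeTerm (4 * h) 0 ω).im := by simp
        rw [h3, one_mul]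
        conv_rhs => rw [← Complex.re_add_im (heckeTerm (4 * h) 0 ω)]
        ring
    refine h2.trans_isBigO (isBigO_of_le _ fun x => ?_)
    simp
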